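/- Let $\pi:E\to M$ be a smooth fibre bundle (more generally, a smooth submersion) with $\dim M=m$ and $\dim E=m+n$, let $\eta$ be a volume form on $M$, let $k\ge 1$, and let $L:J^k\pi\to\mathbb R$ be a smooth function. In adapted coordinates $(x^i,u^\alpha)$ on $E$ write $\eta=f\,d^mx$ (so $f=1$ in coordinates compatible with $\eta$), put $d^{m-1}x_i=i_{\partial/\partial x^i}d^mx$, and let $(x^i,u^\alpha_J)$, $|J|\le k$, be the induced coordinates on $J^k\pi$. Let $\Lambda^m_2(J^{k-1}\pi)$ be the bundle of exterior $m$-forms on $J^{k-1}\pi$ that vanish when two of their arguments are vertical over $M$; its elements are locally $p\,d^mx+\sum_{\alpha,\,|I|\le k-1,\,i}p^{I,i}_\alpha\,du^\alpha_I\wedge d^{m-1}x_i$. Let $$W_0=J^k\pi\times_{J^{k-1}\pi}\Lambda^m_2(J^{k-1}\pi),$$ with coordinates $(x^i,u^\alpha_J,p^{I,i}_\alpha,p)$ and first projection $pr_1:W_0\to J^k\pi$. Let $\Omega=-dp\wedge d^mx-dp^{I,i}_\alpha\wedge du^\alpha_I\wedge d^{m-1}x_i$ be the canonical multisymplectic form.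 Put $H_0=\Phi-L\circ pr_1$, where $\Phi\,\eta=(p+p^{I,i}_\alpha u^\alpha_{I+1_i})\,d^mx$, and $\Omega_{H_0}=\Omega+dH_0\wedge\eta$. A horizontal projector at $w\in W_0$ is a linear map $h_w:T_wW_0\to T_wW_0$ with $h_w^2=h_w$ whose kernel is the vertical space of $W_0\to M$. It solves the dynamical equation if $i_{h_w}\Omega_{H_0}(w)=(m-1)\,\Omega_{H_0}(w)$, where $(i_h\Omega)(v_0,\dots,v_m)=\sum_a\Omega(v_0,\dots,hv_a,\dots,v_m)$. Let $W_1$ be the set of points $w\in W_0$ at which a horizontal projector solving the dynamical equation exists, let $W_2=\{w\in W_1: H_0(w)=0\}$, and for $r\ge 2$ let $W_{r+1}$ be the set of $w\in W_r$ at which there is such a projector with image in $T_wW_r$. Let $W_f=\bigcap_{r\ge 2}W_r$ be the final constraint manifold. (Here $T_wS$ consists of the velocities at $w$ of the smooth curves that lie in $S$; this is the usual tangent space if $S$ is a submanifold.) Let $h=(h_w)_{w\in W_f}$ be a connection along $W_f$ that solves the dynamical equation, that is, a family of horizontal projectors with image in $T_wW_f$ that solve the dynamical equation at every $w\in W_f$.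 Let $\sigma$ be a smooth section of $W_0\to M$ over an open set $U\subseteq M$, with values in $W_f$, that is an integral section of $h$: for every $x\in U$ the image of $T_x\sigma$ is the image of $h_{\sigma(x)}$. Let $\phi:U\to E$ be the projection of $\sigma$ to $E$. Then: 1. $\sigma$ is holonomic: $\phi$ is a smooth section of $\pi$ over $U$ and $pr_1\circ\sigma=j^k\phi$ on $U$. 2. $\phi$ satisfies the higher-order Euler–Lagrange equations: in every adapted coordinate system and for every $\alpha$, $$(j^{2k}\phi)^*\Bigl(\sum_{|J|\le k}(-1)^{|J|}\frac{d^{|J|}}{dx^J}\frac{\partial (fL)}{\partial u^\alpha_J}\Bigr)=0,$$ where $d/dx^i=\partial/\partial x^i+\sum_{\beta,K}u^\beta_{K+1_i}\,\partial/\partial u^\beta_K$. In coordinates compatible with $\eta$, where $f=1$, these are the equations $(j^{2k}\phi)^*\bigl(\sum_{|J|\le k}(-1)^{|J|}\frac{d^{|J|}}{dx^J}\frac{\partial L}{\partial u^\alpha_J}\bigr)=0$. -/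

import Mathlib

open scoped Manifold ContDiff Topology

noncomputable section

namespace SkinnerRusk

/-! ### Multi-indices, partial derivatives and total derivatives -/

/-- Multi-indices `J ∈ ℕ^m` of length `|J| ≤ l`. -/
abbrev MultiIdx (m l : ℕ) : Type := {J : Fin m → ℕ // ∑ i, J i ≤ l}

instance instFiniteMultiIdx (m l : ℕ) : Finite (MultiIdx m l) := by
  refine Finite.of_injective
    (fun J : MultiIdx m l => fun i => (⟨J.1 i, Nat.lt_succ_of_le
      ((Finset.single_le_sum (f := J.1) (fun _ _ => Nat.zero_le _) (Finset.mem_univ i)).trans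
        J.2)⟩ : Fin (l + 1))) ?_
  intro J K h
  apply Subtype.ext
  funext i
  exact congrArg Fin.val (congrFun h i)

instance instFintypeMultiIdx (m l : ℕ) : Fintype (MultiIdx m l) := Fintype.ofFinite _

/-- The multi-index `0`. -/
def MultiIdx.zero (m l : ℕ) : MultiIdx m l := ⟨0, by simp⟩

/-- The multi-index `I + 1_i`. -/
def MultiIdx.succ {m l : ℕ} (I : MultiIdx m l) (i : Fin m) : MultiIdx m (l + 1) :=
  ⟨I.1 + Pi.single i 1, by
    have h : ∑ j, (Pi.single i 1 : Fin m → ℕ) j = 1 := by simp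
    have h2 := I.2
    simp only [Pi.add_apply, Finset.sum_add_distrib, h]
    omega⟩

/-- A multi-index of length at most `l`, seen as a multi-index of length at most `l + 1`. -/
def MultiIdx.castSucc {m l : ℕ} (I : MultiIdx m l) : MultiIdx m (l + 1) :=
  ⟨I.1, I.2.trans (Nat.le_succ l)⟩

/-- `D₁^{J(1)} ∘ ⋯ ∘ D_m^{J(m)}` for operators `D₁, …, D_m` and a multi-index `J`. -/
def multiIterate {A : Type*} {m : ℕ} (D : Fin m → A → A) (J : Fin m → ℕ) (a : A) : A :=
  (List.finRange m).foldr (fun i b => (D i)^[J i] b) a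

/-- The partial derivative `∂f/∂x^i` of a function on `ℝ^m`. -/
def partialDeriv {m : ℕ} (i : Fin m) (f : (Fin m → ℝ) → ℝ) : (Fin m → ℝ) → ℝ :=
  fun x => fderiv ℝ f x (Pi.single i 1)

/-- The iterated partial derivative `∂^{|J|} f/∂x^J`. -/
def iterPartial {m : ℕ} (J : Fin m → ℕ) (f : (Fin m → ℝ) → ℝ) : (Fin m → ℝ) → ℝ :=
  multiIterate partialDeriv J f

/-- Functions of the jet coordinates `(x^i, u^α_J)` of all orders. Only functions that depend on
finitely many of the coordinates `u^α_J` are used. -/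
abbrev JetFunction (m n : ℕ) : Type := (Fin m → ℝ) → (Fin n → (Fin m → ℕ) → ℝ) → ℝ

/-- The coordinate total derivative
`d/dx^i = ∂/∂x^i + ∑_{α,J} u^α_{J+1_i} ∂/∂u^α_J`, i.e. the derivative in the direction of the
vector with components `(1_i, u^α_{J+1_i})`. -/
def totalDeriv {m n : ℕ} (i : Fin m) (G : JetFunction m n) : JetFunction m n := fun x u =>
  deriv (fun t : ℝ => G (x + t • Pi.single i 1)
    (fun α J => u α J + t * u α (J + Pi.single i 1))) 0

/-- The iterated total derivative `d^{|J|}/dx^J`. -/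
def iterTotal {m n : ℕ} (J : Fin m → ℕ) (G : JetFunction m n) : JetFunction m n :=
  multiIterate totalDeriv J G

/-! ### Coordinate spaces and exterior algebra -/

/-- The space of coordinates `(x^i, u^α_J)`, `|J| ≤ l`, of the jets of order `l`. -/
abbrev JetCoord (m n l : ℕ) : Type := (Fin m → ℝ) × (Fin n → MultiIdx m l → ℝ)

/-- The space of coordinates `(x^i, u^α_J, p^{I,i}_α, p)`, `|J| ≤ k`, `|I| ≤ k - 1`, of the mixed
space `W₀`, where `k = r + 1`. -/
abbrev WCoord (m n r : ℕ) : Type :=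
  (Fin m → ℝ) × (Fin n → MultiIdx m (r + 1) → ℝ) × (Fin n → MultiIdx m r → Fin m → ℝ) × ℝ

/-- The coordinate vector `∂/∂x^i` on jets. -/
def jetDx {m n l : ℕ} (i : Fin m) : JetCoord m n l := (Pi.single i 1, 0)

/-- The coordinate vector `∂/∂u^α_J` on jets. -/
def jetDu {m n l : ℕ} (α : Fin n) (J : MultiIdx m l) : JetCoord m n l :=
  (0, Pi.single α (Pi.single J 1))

/-- The covector `dx^i` on the mixed space. -/
def dX {m n r : ℕ} (i : Fin m) : WCoord m n r →ₗ[ℝ] ℝ where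
  toFun v := v.1 i
  map_add' _ _ := rfl
  map_smul' _ _ := rfl

/-- The covector `du^α_J` on the mixed space. -/
def dU {m n r : ℕ} (α : Fin n) (J : MultiIdx m (r + 1)) : WCoord m n r →ₗ[ℝ] ℝ where
  toFun v := v.2.1 α J
  map_add' _ _ := rfl
  map_smul' _ _ := rfl

/-- The covector `dp^{I,i}_α` on the mixed space. -/
def dMom {m n r : ℕ} (α : Fin n) (I : MultiIdx m r) (i : Fin m) : WCoord m n r →ₗ[ℝ] ℝ where
  toFun v := v.2.2.1 α I i
  map_add' _ _ := rfl
  map_smul' _ _ := rfl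

/-- The covector `dp` on the mixed space. -/
def dP {m n r : ℕ} : WCoord m n r →ₗ[ℝ] ℝ where
  toFun v := v.2.2.2
  map_add' _ _ := rfl
  map_smul' _ _ := rfl

/-- The exterior product `θ₁ ∧ ⋯ ∧ θ_q` of covectors, `v ↦ det (θ_a (v_b))`. -/
def wedge {V : Type*} [AddCommGroup V] [Module ℝ V] {q : ℕ} (θ : Fin q → (V →ₗ[ℝ] ℝ)) :
    V [⋀^Fin q]→ₗ[ℝ] ℝ :=
  (Matrix.detRowAlternating (R := ℝ) (n := Fin q)).compLinearMap (LinearMap.pi θ)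

/-- The function `g ∘ c⁻¹`, for an injective coordinate map `c` on the set `s`; it is zero outside
`c(s)`. -/
def inCoords {X C Y : Type*} [Zero Y] (s : Set X) (c : X → C) (g : X → Y) (y : C) : Y :=
  open Classical in if h : ∃ x ∈ s, c x = y then g h.choose else 0

section Bundle

variable {m n : ℕ}
  {M : Type*} [TopologicalSpace M] [ChartedSpace (EuclideanSpace ℝ (Fin m)) M]
  {E : Type*} [TopologicalSpace E] [ChartedSpace (EuclideanSpace ℝ (Fin (m + n))) E]

/-! ### Coordinates on the base and volume forms -/

/-- A smooth local coordinate system `(x^i)` on `M`. -/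
def IsCoordinateSystem (c : OpenPartialHomeomorph M (Fin m → ℝ)) : Prop :=
  ContMDiffOn (𝓡 m) 𝓘(ℝ, Fin m → ℝ) ∞ c c.source ∧
    ContMDiffOn 𝓘(ℝ, Fin m → ℝ) (𝓡 m) ∞ c.symm c.target

/-- The function `f` such that `η = f dx^1 ∧ ⋯ ∧ dx^m` in the coordinate system `c`. -/
def density (η : ∀ x : M, TangentSpace (𝓡 m) x [⋀^Fin m]→ₗ[ℝ] ℝ)
    (c : OpenPartialHomeomorph M (Fin m → ℝ)) (x : Fin m → ℝ) : ℝ :=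
  η (c.symm x) (fun i => mfderiv 𝓘(ℝ, Fin m → ℝ) (𝓡 m) c.symm x
    (Pi.single i 1 : Fin m → ℝ))

variable (m M) in
/-- A volume form on `M`: a smooth nowhere vanishing form of degree `m = dim M`. -/
structure VolumeForm where
  toFun : ∀ x : M, TangentSpace (𝓡 m) x [⋀^Fin m]→ₗ[ℝ] ℝ
  ne_zero : ∀ x, toFun x ≠ 0
  smooth : ∀ c : OpenPartialHomeomorph M (Fin m → ℝ), IsCoordinateSystem c →
    ContDiffOn ℝ ∞ (density toFun c) c.target

/-! ### Adapted charts and jets -/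

variable (m n) in
/-- An adapted coordinate system `(x^i, u^α)` on `E`, over a coordinate system `(x^i)` on `M`. -/
structure AdaptedChart (π : E → M) where
  base : OpenPartialHomeomorph M (Fin m → ℝ)
  total : OpenPartialHomeomorph E ((Fin m → ℝ) × (Fin n → ℝ))
  isCoordinateSystem_base : IsCoordinateSystem base
  smooth_total :
    ContMDiffOn (𝓡 (m + n)) 𝓘(ℝ, (Fin m → ℝ) × (Fin n → ℝ)) ∞ total total.source
  smooth_total_symm :
    ContMDiffOn 𝓘(ℝ, (Fin m → ℝ) × (Fin n → ℝ)) (𝓡 (m + n)) ∞ total.symm total.target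
  mapsTo : ∀ y ∈ total.source, π y ∈ base.source
  fst_total : ∀ y ∈ total.source, (total y).1 = base (π y)

variable (m n) in
/-- `φ` is, on a neighbourhood of `x`, a smooth section of `π`. -/
def IsLocalSectionAt (π : E → M) (φ : M → E) (x : M) : Prop :=
  ∀ᶠ y in 𝓝 x, π (φ y) = y ∧ ContMDiffAt (𝓡 m) (𝓡 (m + n)) ∞ φ y

/-- The function `φ^α(x^1, …, x^m)` that represents the map `φ : M → E` in an adapted chart. -/
def AdaptedChart.sectionRep {π : E → M} (e : AdaptedChart m n π) (φ : M → E) (α : Fin n) :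
    (Fin m → ℝ) → ℝ :=
  fun x => (e.total (φ (e.base.symm x))).2 α

variable (m n) in
/-- A point of `M` together with a smooth local section of `π` around it. -/
structure PointedSection (π : E → M) where
  pt : M
  toFun : M → E
  isLocalSection : IsLocalSectionAt m n π toFun pt

/-- The coordinates `x^i` and `∂^{|J|}φ^α/∂x^J`, `|J| ≤ l`, of a local section at its point. -/
def PointedSection.coords {π : E → M} (l : ℕ) (e : AdaptedChart m n π)
    (s : PointedSection m n π) : JetCoord m n l :=
  (e.base s.pt, fun α J => iterPartial J.1 (e.sectionRep s.toFun α) (e.base s.pt))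

variable (m n) in
/-- `l`-equivalence: two local sections at the same point have the same value and the same partial
derivatives up to order `l` (in every adapted chart around the value). -/
def jetSetoid (π : E → M) (l : ℕ) : Setoid (PointedSection m n π) where
  r s t := s.pt = t.pt ∧ s.toFun s.pt = t.toFun t.pt ∧
    ∀ e : AdaptedChart m n π, s.toFun s.pt ∈ e.total.source → s.coords l e = t.coords l e
  iseqv :=
    { refl := fun _ => ⟨rfl, rfl, fun _ _ => rfl⟩
      symm := fun h => ⟨h.1.symm, h.2.1.symm, fun e he => (h.2.2 e (h.2.1 ▸ he)).symm⟩
      trans := fun h h' => ⟨h.1.trans h'.1, h.2.1.trans h'.2.1,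
        fun e he => (h.2.2 e he).trans (h'.2.2 e (h.2.1 ▸ he))⟩ }

variable (m n) in
/-- The jet space `J^l π`. For `l = 0` this is `E` (more precisely, the set of values of local
sections). -/
def Jet (π : E → M) (l : ℕ) : Type _ := Quotient (jetSetoid m n π l)

/-- The jet `j^l_x φ` of a local section at `x`. -/
def Jet.mk {π : E → M} (l : ℕ) (x : M) (φ : M → E) (hφ : IsLocalSectionAt m n π φ x) :
    Jet m n π l :=
  Quotient.mk (jetSetoid m n π l) ⟨x, φ, hφ⟩

/-- The projection `J^l π → M`. -/
def Jet.pt {π : E → M} {l : ℕ} : Jet m n π l → M :=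
  Quotient.lift PointedSection.pt (fun _ _ h => h.1)

/-- The projection `J^l π → E`. -/
def Jet.value {π : E → M} {l : ℕ} : Jet m n π l → E :=
  Quotient.lift (fun s => s.toFun s.pt) (fun _ _ h => h.2.1)

/-- The domain in `J^l π` of the coordinate system induced by an adapted chart. -/
def Jet.domain {π : E → M} {l : ℕ} (e : AdaptedChart m n π) : Set (Jet m n π l) :=
  {z | z.value ∈ e.total.source}

open Classical in
/-- The coordinates `(x^i, u^α_J)`, `|J| ≤ l`, of a jet in an adapted chart (zero outside the
domain). -/
def Jet.coord {π : E → M} {l : ℕ} (e : AdaptedChart m n π) : Jet m n π l → JetCoord m n l :=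
  Quotient.lift (fun s => if s.toFun s.pt ∈ e.total.source then s.coords l e else 0) (by
    intro s t h
    by_cases hs : s.toFun s.pt ∈ e.total.source
    · have ht : t.toFun t.pt ∈ e.total.source := h.2.1 ▸ hs
      simp only [if_pos hs, if_pos ht]
      exact h.2.2 e hs
    · have ht : t.toFun t.pt ∉ e.total.source := h.2.1 ▸ hs
      simp only [if_neg hs, if_neg ht])

/-- The projection `J^{l+1} π → J^l π`. -/
def Jet.proj {π : E → M} {l : ℕ} : Jet m n π (l + 1) → Jet m n π l :=
  Quotient.map' id (by
    intro s t h
    refine ⟨h.1, h.2.1, fun e he => ?_⟩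
    have h2 := h.2.2 e he
    refine Prod.ext (congrArg Prod.fst h2 :) ?_
    funext α J
    exact congrFun (congrFun (congrArg Prod.snd h2) α) J.castSucc)

/-- The change of coordinates on `J^l π` between two adapted charts. -/
def Jet.transition {π : E → M} (l : ℕ) (e e' : AdaptedChart m n π) :
    JetCoord m n l → JetCoord m n l :=
  inCoords (Jet.domain e) (Jet.coord e) (Jet.coord (l := l) e')

/-! ### The Lagrangian -/

/-- The expression `L(x^i, u^α_J)` of a function on `J^l π` in an adapted chart. -/
def lagrangianRep {π : E → M} {l : ℕ} (L : Jet m n π l → ℝ) (e : AdaptedChart m n π) :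
    JetCoord m n l → ℝ :=
  inCoords (Jet.domain e) (Jet.coord e) L

/-- Smoothness of a function on `J^l π`: its expression in every adapted chart is smooth on the
open set of coordinates of jets in the domain of the chart. -/
def IsSmoothLagrangian {π : E → M} {l : ℕ} (L : Jet m n π l → ℝ) : Prop :=
  ∀ e : AdaptedChart m n π, ContDiffOn ℝ ∞ (lagrangianRep L e)
    {y | (y.1, fun α => y.2 α (MultiIdx.zero m l)) ∈ e.total.target}

/-- The Euler–Lagrange expression `∑_{|J| ≤ k} (-1)^{|J|} d^{|J|}/dx^J (∂(f L)/∂u^α_J)` in an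
adapted chart with `η = f d^m x`. The function `f`, which depends on `x` only, is `1` when the chart
is compatible with `η`. The expression involves the coordinates `u^β_K` with `|K| ≤ 2k` only. -/
def eulerLagrange {π : E → M} {l : ℕ} (η : VolumeForm m M) (L : Jet m n π l → ℝ)
    (e : AdaptedChart m n π) (α : Fin n) : JetFunction m n := fun x u =>
  ∑ J : MultiIdx m l, (-1 : ℝ) ^ (∑ i, J.1 i) *
    iterTotal J.1 (fun x' u' =>
      fderiv ℝ (fun y : JetCoord m n l => density η.toFun e.base y.1 * lagrangianRep L e y)
        (x', fun β K => u' β K.1) (jetDu α J)) x u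

/-! ### The mixed space -/

/-- An element over `z ∈ J^l π` of the bundle `Λ^m_2(J^l π)`: an exterior `m`-form on the tangent
space at `z`, given by its expressions in the coordinate systems around `z`, that vanishes whenever
two of its arguments are vertical over `M`. -/
@[ext]
structure SemibasicForm {π : E → M} {l : ℕ} (z : Jet m n π l) where
  comp : ∀ e : AdaptedChart m n π, z ∈ Jet.domain e → JetCoord m n l [⋀^Fin m]→ₗ[ℝ] ℝ
  transform : ∀ (e e' : AdaptedChart m n π) (he : z ∈ Jet.domain e) (he' : z ∈ Jet.domain e'),
    comp e he = (comp e' he').compLinearMap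
      (fderiv ℝ (Jet.transition l e e') (Jet.coord e z)).toLinearMap
  two_vertical : ∀ (e : AdaptedChart m n π) (he : z ∈ Jet.domain e)
    (v : Fin m → JetCoord m n l) (a b : Fin m), a ≠ b → (v a).1 = 0 → (v b).1 = 0 →
    comp e he v = 0

variable (m n) in
/-- The mixed space `W₀ = J^k π ×_{J^{k-1} π} Λ^m_2(J^{k-1} π)`, where `k = r + 1`. -/
structure MixedSpace (π : E → M) (r : ℕ) where
  /-- The projection `pr₁ : W₀ → J^k π`. -/
  jet : Jet m n π (r + 1)
  /-- The second component, a form at the projection of the jet to `J^{k-1} π`. -/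
  form : SemibasicForm jet.proj

namespace MixedSpace

variable {π : E → M} {r : ℕ}

/-- The projection `W₀ → M`. -/
def pt (w : MixedSpace m n π r) : M := w.jet.pt

/-- The projection `W₀ → E`. -/
def value (w : MixedSpace m n π r) : E := w.jet.value

/-- The domain in `W₀` of the coordinate system induced by an adapted chart. -/
def domain (e : AdaptedChart m n π) : Set (MixedSpace m n π r) :=
  {w | w.jet.proj ∈ Jet.domain e}

open Classical in
/-- The coordinates `(x^i, u^α_J, p^{I,i}_α, p)` of a point of `W₀` in an adapted chart (zero
outside the domain). Here `p` and `p^{I,i}_α` are the coefficients of the form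
`p d^m x + p^{I,i}_α du^α_I ∧ d^{m-1}x_i`, that is, its values on `(∂/∂x^1, …, ∂/∂x^m)` and on the
same vectors with the `i`-th one replaced by `∂/∂u^α_I`. -/
def coord (e : AdaptedChart m n π) (w : MixedSpace m n π r) : WCoord m n r :=
  if h : w ∈ domain e then
    ((w.jet.coord e).1, (w.jet.coord e).2,
      fun α I i => w.form.comp e h (Function.update jetDx i (jetDu α I)),
      w.form.comp e h jetDx)
  else 0

/-- The change of coordinates on `W₀` between two adapted charts. -/
def transition (r : ℕ) (e e' : AdaptedChart m n π) : WCoord m n r → WCoord m n r :=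
  inCoords (domain e) (coord e) (coord (r := r) e')

end MixedSpace

/-! ### The Hamiltonian and the premultisymplectic form, in adapted charts -/

variable {π : E → M} {r : ℕ}

/-- The function `H₀ = Φ - L ∘ pr₁` in an adapted chart. The pairing `Φ` is given by
`Φ η = (p^{I,i}_α u^α_{I+1_i} + p) d^m x`. -/
def hamiltonian (η : VolumeForm m M) (L : Jet m n π (r + 1) → ℝ) (e : AdaptedChart m n π)
    (y : WCoord m n r) : ℝ :=
  ((∑ α, ∑ I : MultiIdx m r, ∑ i, y.2.2.1 α I i * y.2.1 α (I.succ i)) + y.2.2.2) /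
      density η.toFun e.base y.1
    - lagrangianRep L e (y.1, y.2.1)

/-- The form `Ω_{H₀} = Ω + dH₀ ∧ η` in an adapted chart, where
`Ω = - dp ∧ d^m x - dp^{I,i}_α ∧ du^α_I ∧ d^{m-1}x_i` is the canonical multisymplectic form. Note
that `du^α_I ∧ d^{m-1}x_i` is `dx^1 ∧ ⋯ ∧ dx^m` with the factor `dx^i` replaced by `du^α_I`. -/
def omegaH (η : VolumeForm m M) (L : Jet m n π (r + 1) → ℝ) (e : AdaptedChart m n π)
    (y : WCoord m n r) : WCoord m n r [⋀^Fin (m + 1)]→ₗ[ℝ] ℝ :=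
  - wedge (Fin.cons dP dX : Fin (m + 1) → (WCoord m n r →ₗ[ℝ] ℝ))
  - (∑ α, ∑ I : MultiIdx m r, ∑ i,
      wedge (Fin.cons (dMom α I i) (Function.update dX i (dU α I.castSucc)) :
        Fin (m + 1) → (WCoord m n r →ₗ[ℝ] ℝ)))
  + density η.toFun e.base y.1 •
      wedge (Fin.cons (fderiv ℝ (hamiltonian η L e) y).toLinearMap dX :
        Fin (m + 1) → (WCoord m n r →ₗ[ℝ] ℝ))

/-! ### Horizontal projectors and the constraint algorithm -/

/-- A linear endomorphism of the tangent space `T_w W₀`, given by its expressions in the coordinate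
systems around `w`. -/
structure TangentEnd (w : MixedSpace m n π r) where
  comp : ∀ e : AdaptedChart m n π, w ∈ MixedSpace.domain e → WCoord m n r →ₗ[ℝ] WCoord m n r
  transform : ∀ (e e' : AdaptedChart m n π) (he : w ∈ MixedSpace.domain e)
    (he' : w ∈ MixedSpace.domain e'),
    (fderiv ℝ (MixedSpace.transition r e e') (MixedSpace.coord e w)).toLinearMap ∘ₗ comp e he =
      comp e' he' ∘ₗ
        (fderiv ℝ (MixedSpace.transition r e e') (MixedSpace.coord e w)).toLinearMap

/-- `h² = h` and `ker h` is the vertical space of `W₀ → M`. -/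
def TangentEnd.IsHorizontalProjector {w : MixedSpace m n π r} (h : TangentEnd w) : Prop :=
  ∀ (e : AdaptedChart m n π) (he : w ∈ MixedSpace.domain e),
    h.comp e he ∘ₗ h.comp e he = h.comp e he ∧
    ∀ v : WCoord m n r, h.comp e he v = 0 ↔ v.1 = 0

/-- The dynamical equation `i_h Ω_{H₀} = (m - 1) Ω_{H₀}` at `w`, where
`(i_h Ω)(v₀, …, v_m) = ∑_a Ω(v₀, …, h v_a, …, v_m)`. -/
def TangentEnd.SolvesDynamicalEq {w : MixedSpace m n π r} (h : TangentEnd w)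
    (η : VolumeForm m M) (L : Jet m n π (r + 1) → ℝ) : Prop :=
  ∀ (e : AdaptedChart m n π) (he : w ∈ MixedSpace.domain e) (v : Fin (m + 1) → WCoord m n r),
    ∑ a, omegaH η L e (MixedSpace.coord e w) (Function.update v a (h.comp e he (v a))) =
      ((m : ℝ) - 1) * omegaH η L e (MixedSpace.coord e w) v

/-- A curve in `W₀` that is smooth near the parameter `0`. -/
def IsSmoothCurve (γ : ℝ → MixedSpace m n π r) : Prop :=
  ∀ e : AdaptedChart m n π, γ 0 ∈ MixedSpace.domain e →
    ∀ᶠ t in 𝓝 (0 : ℝ), γ t ∈ MixedSpace.domain e ∧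
      ContDiffAt ℝ ∞ (fun s => MixedSpace.coord e (γ s)) t

/-- The tangent space at `w` of a submanifold `S` of `W₀`, in an adapted chart: the velocities of
the smooth curves in `S` through `w`. -/
def tangentSet (S : Set (MixedSpace m n π r)) (w : MixedSpace m n π r)
    (e : AdaptedChart m n π) : Set (WCoord m n r) :=
  {v | ∃ γ : ℝ → MixedSpace m n π r, γ 0 = w ∧ IsSmoothCurve γ ∧ (∀ᶠ t in 𝓝 (0 : ℝ), γ t ∈ S) ∧
    deriv (fun t => MixedSpace.coord e (γ t)) 0 = v}

/-- `h` takes values in the tangent space `T_w S`. -/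
def TangentEnd.IsTangentTo {w : MixedSpace m n π r} (h : TangentEnd w)
    (S : Set (MixedSpace m n π r)) : Prop :=
  ∀ (e : AdaptedChart m n π) (he : w ∈ MixedSpace.domain e) (v : WCoord m n r),
    h.comp e he v ∈ tangentSet S w e

/-- The set `W₁` of points of `W₀` at which the dynamical equation has a solution. -/
def W1 (η : VolumeForm m M) (L : Jet m n π (r + 1) → ℝ) : Set (MixedSpace m n π r) :=
  {w | ∃ h : TangentEnd w, h.IsHorizontalProjector ∧ h.SolvesDynamicalEq η L}

/-- The set `W₂` of points of `W₁` with `H₀ = 0`. -/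
def W2 (η : VolumeForm m M) (L : Jet m n π (r + 1) → ℝ) : Set (MixedSpace m n π r) :=
  {w | w ∈ W1 η L ∧ ∀ e : AdaptedChart m n π, w ∈ MixedSpace.domain e →
    hamiltonian η L e (MixedSpace.coord e w) = 0}

/-- The constraint algorithm `W₂, W₃, W₄, …`: the next set consists of the points at which the
dynamical equation has a solution that is tangent to the previous one. -/
def constraintSet (η : VolumeForm m M) (L : Jet m n π (r + 1) → ℝ) :
    ℕ → Set (MixedSpace m n π r)
  | 0 => W2 η L
  | j + 1 => {w | w ∈ constraintSet η L j ∧ ∃ h : TangentEnd w,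
      h.IsHorizontalProjector ∧ h.SolvesDynamicalEq η L ∧ h.IsTangentTo (constraintSet η L j)}

/-- The final constraint set `W_f`, at which the algorithm `W₂ ⊇ W₃ ⊇ ⋯` arrives. -/
def finalConstraintSet (η : VolumeForm m M) (L : Jet m n π (r + 1) → ℝ) :
    Set (MixedSpace m n π r) :=
  ⋂ j, constraintSet η L j

/-- `h` is (the horizontal projector of) a connection in `W₀ → M` along `S` that solves the
dynamical equation. -/
def IsSolutionAlong (η : VolumeForm m M) (L : Jet m n π (r + 1) → ℝ)
    (S : Set (MixedSpace m n π r)) (h : ∀ w : MixedSpace m n π r, TangentEnd w) : Prop :=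
  ∀ w ∈ S, (h w).IsHorizontalProjector ∧ (h w).IsTangentTo S ∧ (h w).SolvesDynamicalEq η L

/-! ### Sections of the mixed space -/

/-- The expression of a map `σ : M → W₀` in an adapted chart. -/
def mixedRep (σ : M → MixedSpace m n π r) (e : AdaptedChart m n π) :
    (Fin m → ℝ) → WCoord m n r :=
  fun x => MixedSpace.coord e (σ (e.base.symm x))

/-- `σ` is a smooth section of `W₀ → M` over the open set `U`. -/
def IsSmoothSectionOn (σ : M → MixedSpace m n π r) (U : Set M) : Prop :=
  ∀ x ∈ U, (σ x).pt = x ∧ ∀ e : AdaptedChart m n π, σ x ∈ MixedSpace.domain e →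
    (∀ᶠ y in 𝓝 x, σ y ∈ MixedSpace.domain e) ∧
      ContDiffAt ℝ ∞ (mixedRep σ e) (e.base x)

/-- `σ` is an integral section of `h` over `U`: the tangent space at `σ(x)` of the image of `σ` is
the horizontal space, the image of `h` at `σ(x)`. -/
def IsIntegralSectionOn (h : ∀ w : MixedSpace m n π r, TangentEnd w)
    (σ : M → MixedSpace m n π r) (U : Set M) : Prop :=
  ∀ x ∈ U, ∀ (e : AdaptedChart m n π) (he : σ x ∈ MixedSpace.domain e),
    (fderiv ℝ (mixedRep σ e) (e.base x)).toLinearMap.range = ((h (σ x)).comp e he).range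

end Bundle

end SkinnerRusk

end

open SkinnerRusk

/-!
The statement is local. In an adapted chart with `η = f d^m x` the section `σ` is a tuple of
functions `(u^α_J(x), p^{I,i}_α(x), p(x))`, and the images `H_i` of `∂/∂x^i` under its derivative
form a frame of the horizontal space of `h`. Inserting a vertical vector `V` and this frame into
the dynamical equation gives `m Ω_{H₀}(V, H_1, …, H_m) = (m - 1) Ω_{H₀}(V, H_1, …, H_m)`, because
`h` kills `V` and fixes the `H_i`; hence `Ω_{H₀}(V, H_1, …, H_m) = 0`
(`TangentEnd.omegaH_eq_zero`). Two families of vertical vectors yield all that is needed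
(`integralSection_equations`):

* `V = ∂/∂p^{I,i}_α` gives `∂u^α_I/∂x^i = u^α_{I+1_i}` for `|I| ≤ k - 1`. By induction on the
  multi-index, the `u^α_J` are the derivatives of `u^α_0`, so the jet component of `σ` is the
  prolongation of its projection to `E` (`jet_eq_mk_value`).
* `V = ∂/∂u^α_J` gives `∑_i ∂p^{J,i}_α/∂x^i + ∑_{I+1_i=J} p^{I,i}_α = ∂(fL)/∂u^α_J` for `|J| ≤ k`,
  where the first sum is absent if `|J| = k`.

Along the prolongation of a section, total derivatives become partial derivatives
(`iterTotal_prolongation`), so the Euler–Lagrange expression is the sum of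
`(-1)^{|J|} ∂^{|J|}/∂x^J` applied to the left-hand sides of the second family of equations. In that
sum each momentum `p^{I,i}_α` occurs twice with the same derivative `∂^{I+1_i}` and with opposite
signs (`sum_iterPartial_momenta_eq_zero`).

The submersion hypothesis provides adapted charts around every point of `E`, which are needed for
the smoothness of the projected section (`exists_adaptedChart`). A volume form has a nonvanishing
density (`density_ne_zero`), so that the factor `1 / f` in `H₀` cancels against `η = f d^m x`.
-/

namespace SkinnerRusk

/-! ### Iterated partial derivatives on an open set -/

/-- Induction over multi-indices that raises one exponent at a time. -/
theorem multiIndex_induction {m : ℕ} {P : (Fin m → ℕ) → Prop} (zero : P 0)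
    (step : ∀ I i, P I → P (I + Pi.single i 1)) (J : Fin m → ℕ) : P J := by
  induction h : ∑ i, J i generalizing J with
  | zero =>
    have : J = 0 := by
      funext i
      exact (Finset.sum_eq_zero_iff.mp h) i (Finset.mem_univ i)
    exact this ▸ zero
  | succ s ih =>
    obtain ⟨i, -, hi⟩ : ∃ i ∈ Finset.univ, J i ≠ 0 := by
      by_contra! hJ
      rw [Finset.sum_eq_zero hJ] at h
      omega
    have hJ : J = (J - Pi.single i 1) + Pi.single i 1 := by
      funext j
      by_cases hj : j = i
      · subst hj
        simp
        omega
      · simp [hj]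
    rw [hJ]
    refine step _ i (ih _ ?_)
    rw [hJ] at h
    simp only [Pi.add_apply, Finset.sum_add_distrib, Finset.sum_pi_single', Finset.mem_univ,
      if_true] at h
    have h1 : ∑ j, (Pi.single i 1 : Fin m → ℕ) j = 1 := by simp
    omega

/-- A relation that is preserved by two families of operators is preserved by their iterates. -/
theorem multiIterate_rel {A B : Type*} {m : ℕ} {D : Fin m → A → A} {D' : Fin m → B → B}
    {R : A → B → Prop} (hR : ∀ i a b, R a b → R (D i a) (D' i b)) (J : Fin m → ℕ) {a : A} {b : B}
    (h : R a b) : R (multiIterate D J a) (multiIterate D' J b) := by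
  unfold multiIterate
  induction List.finRange m with
  | nil => exact h
  | cons i l ih =>
    simp only [List.foldr_cons]
    induction J i with
    | zero => exact ih
    | succ k ihk =>
      rw [Function.iterate_succ_apply', Function.iterate_succ_apply']
      exact hR _ _ _ ihk

@[simp]
theorem iterPartial_zero {m : ℕ} (f : (Fin m → ℝ) → ℝ) : iterPartial 0 f = f := by
  simp [iterPartial, multiIterate]

section PartialDeriv

variable {m : ℕ} {V : Set (Fin m → ℝ)} {f g : (Fin m → ℝ) → ℝ}

theorem partialDeriv_congr (hV : IsOpen V) (h : Set.EqOn f g V) (i : Fin m) :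
    Set.EqOn (partialDeriv i f) (partialDeriv i g) V := fun x hx => by
  unfold partialDeriv
  rw [(h.eventuallyEq_of_mem (hV.mem_nhds hx)).fderiv_eq]

theorem contDiffOn_partialDeriv (hV : IsOpen V) (hf : ContDiffOn ℝ ∞ f V) (i : Fin m) :
    ContDiffOn ℝ ∞ (partialDeriv i f) V :=
  (hf.fderiv_of_isOpen hV (m := ∞) (by simp)).clm_apply contDiffOn_const

theorem partialDeriv_comm (hV : IsOpen V) (hf : ContDiffOn ℝ ∞ f V) (i j : Fin m) :
    Set.EqOn (partialDeriv i (partialDeriv j f)) (partialDeriv j (partialDeriv i f)) V := by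
  intro x hx
  have hf' : ContDiffAt ℝ ∞ f x := hf.contDiffAt (hV.mem_nhds hx)
  have hd : DifferentiableAt ℝ (fderiv ℝ f) x :=
    ((hf.fderiv_of_isOpen hV (m := ∞) (by simp)).contDiffAt (hV.mem_nhds hx)).differentiableAt
      (by simp)
  have hs : IsSymmSndFDerivAt ℝ f x :=
    hf'.isSymmSndFDerivAt (by simpa using (by norm_cast : (2 : ℕ∞ω) ≤ ∞))
  have key : ∀ a b : Fin m, partialDeriv a (partialDeriv b f) x
      = fderiv ℝ (fderiv ℝ f) x (Pi.single a 1) (Pi.single b 1) := by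
    intro a b
    unfold partialDeriv
    rw [fderiv_clm_apply hd (differentiableAt_const _)]
    simp
  rw [key, key]
  exact hs _ _

theorem iterPartial_congr (hV : IsOpen V) (h : Set.EqOn f g V) (J : Fin m → ℕ) :
    Set.EqOn (iterPartial J f) (iterPartial J g) V :=
  multiIterate_rel (R := fun f g => Set.EqOn f g V)
    (fun i _ _ h => partialDeriv_congr hV h i) J h

theorem contDiffOn_iterPartial (hV : IsOpen V) (hf : ContDiffOn ℝ ∞ f V) (J : Fin m → ℕ) :
    ContDiffOn ℝ ∞ (iterPartial J f) V :=
  multiIterate_rel (R := fun f (_ : (Fin m → ℝ) → ℝ) => ContDiffOn ℝ ∞ f V)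
    (D' := partialDeriv) (fun i _ _ h => contDiffOn_partialDeriv hV h i) J (b := f) hf

/-- Iterated partial derivatives commute with partial derivatives. -/
theorem partialDeriv_iterPartial (hV : IsOpen V) (hf : ContDiffOn ℝ ∞ f V) (J : Fin m → ℕ)
    (i : Fin m) :
    Set.EqOn (partialDeriv i (iterPartial J f)) (iterPartial J (partialDeriv i f)) V :=
  (multiIterate_rel (R := fun a b => ContDiffOn ℝ ∞ a V ∧ Set.EqOn (partialDeriv i a) b V)
    (fun j _ _ h => ⟨contDiffOn_partialDeriv hV h.1 j,
      (partialDeriv_comm hV h.1 i j).trans (partialDeriv_congr hV h.2 j)⟩)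
    J ⟨hf, fun _ _ => rfl⟩).2

theorem contDiffOn_iterate_partialDeriv (hV : IsOpen V) (hf : ContDiffOn ℝ ∞ f V) (j : Fin m)
    (k : ℕ) : ContDiffOn ℝ ∞ ((partialDeriv j)^[k] f) V := by
  induction k with
  | zero => exact hf
  | succ k ih =>
    rw [Function.iterate_succ_apply']
    exact contDiffOn_partialDeriv hV ih j

/-- `∂/∂x^i ∂^{|J|}/∂x^J = ∂^{|J|+1}/∂x^{J+1_i}` on smooth functions. -/
theorem partialDeriv_iterPartial_eq_add_single (hV : IsOpen V) (hf : ContDiffOn ℝ ∞ f V)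
    (J : Fin m → ℕ) (i : Fin m) :
    Set.EqOn (partialDeriv i (iterPartial J f)) (iterPartial (J + Pi.single i 1) f) V := by
  have smooth : ∀ l : List (Fin m),
      ContDiffOn ℝ ∞ (l.foldr (fun i b => (partialDeriv i)^[J i] b) f) V := by
    intro l
    induction l with
    | nil => exact hf
    | cons j l ih => exact contDiffOn_iterate_partialDeriv hV ih j _
  have absent : ∀ l : List (Fin m), i ∉ l →
      l.foldr (fun j b => (partialDeriv j)^[(J + Pi.single i 1 : Fin m → ℕ) j] b) f
        = l.foldr (fun j b => (partialDeriv j)^[J j] b) f := by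
    intro l hl
    induction l with
    | nil => rfl
    | cons j l ih =>
      simp only [List.mem_cons, not_or] at hl
      have hj : (J + Pi.single i 1 : Fin m → ℕ) j = J j := by simp [Ne.symm hl.1]
      simp only [List.foldr_cons, ih hl.2, hj]
  -- The derivatives are applied in the order of the list of all indices; the claim holds along
  -- every list in which `i` occurs exactly once.
  have present : ∀ l : List (Fin m), l.Nodup → i ∈ l →
      Set.EqOn (partialDeriv i (l.foldr (fun j b => (partialDeriv j)^[J j] b) f))
        (l.foldr (fun j b => (partialDeriv j)^[(J + Pi.single i 1 : Fin m → ℕ) j] b) f) V := by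
    intro l hl hi
    induction l with
    | nil => simp at hi
    | cons j l ih =>
      rw [List.nodup_cons] at hl
      simp only [List.foldr_cons]
      by_cases hj : j = i
      · subst hj
        have hJ : (J + Pi.single j 1 : Fin m → ℕ) j = J j + 1 := by simp
        rw [absent l hl.1, hJ, Function.iterate_succ_apply']
        exact fun _ _ => rfl
      · have hJ : (J + Pi.single i 1 : Fin m → ℕ) j = J j := by simp [hj]
        rw [hJ]
        have hil : i ∈ l := by
          rcases List.mem_cons.mp hi with h | h
          · exact absurd h.symm hj
          · exact h
        have h0 := ih hl.2 hil
        have hs := smooth l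
        generalize l.foldr (fun j b => (partialDeriv j)^[J j] b) f = F at h0 hs ⊢
        generalize l.foldr (fun j b => (partialDeriv j)^[(J + Pi.single i 1 : Fin m → ℕ) j] b) f
          = G at h0 ⊢
        induction J j with
        | zero => exact h0
        | succ k ihk =>
          rw [Function.iterate_succ_apply', Function.iterate_succ_apply']
          exact (partialDeriv_comm hV (contDiffOn_iterate_partialDeriv hV hs j k) i j).trans
            (partialDeriv_congr hV ihk j)
  exact present _ (List.nodup_finRange m) (List.mem_finRange i)

theorem partialDeriv_finset_sum {ι : Type*} (hV : IsOpen V) (s : Finset ι)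
    {F : ι → (Fin m → ℝ) → ℝ} (hF : ∀ a ∈ s, ContDiffOn ℝ ∞ (F a) V) (i : Fin m) :
    Set.EqOn (partialDeriv i (fun x => ∑ a ∈ s, F a x)) (fun x => ∑ a ∈ s, partialDeriv i (F a) x)
      V := by
  intro x hx
  unfold partialDeriv
  rw [fderiv_fun_sum fun a ha =>
    ((hF a ha).contDiffAt (hV.mem_nhds hx)).differentiableAt (by simp)]
  simp

theorem iterPartial_finset_sum {ι : Type*} (hV : IsOpen V) (s : Finset ι)
    {F : ι → (Fin m → ℝ) → ℝ} (hF : ∀ a ∈ s, ContDiffOn ℝ ∞ (F a) V) (J : Fin m → ℕ) :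
    Set.EqOn (iterPartial J (fun x => ∑ a ∈ s, F a x)) (fun x => ∑ a ∈ s, iterPartial J (F a) x)
      V := by
  have hsum : ContDiffOn ℝ ∞ (fun x => ∑ a ∈ s, F a x) V := ContDiffOn.sum hF
  induction J using multiIndex_induction with
  | zero => simp [Set.EqOn]
  | step I i ih =>
    refine (partialDeriv_iterPartial_eq_add_single hV hsum I i).symm.trans
      ((partialDeriv_congr hV ih i).trans
        ((partialDeriv_finset_sum hV s (fun a ha => contDiffOn_iterPartial hV (hF a ha) I) i).trans
          fun x hx => Finset.sum_congr rfl fun a ha =>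
            partialDeriv_iterPartial_eq_add_single hV (hF a ha) I i hx))

/-- A family `u_J`, `|J| ≤ l + 1`, with `∂u_I/∂x^i = u_{I+1_i}` for `|I| ≤ l` consists of the
derivatives of `u_0`. -/
theorem iterPartial_eq_of_partialDeriv_eq {l : ℕ} (hV : IsOpen V)
    {u : MultiIdx m (l + 1) → (Fin m → ℝ) → ℝ}
    (hu : ContDiffOn ℝ ∞ (u (MultiIdx.zero m (l + 1))) V)
    (h : ∀ (I : MultiIdx m l) (i : Fin m),
      Set.EqOn (partialDeriv i (u I.castSucc)) (u (I.succ i)) V)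
    (J : MultiIdx m (l + 1)) :
    Set.EqOn (iterPartial J.1 (u (MultiIdx.zero m (l + 1)))) (u J) V := by
  obtain ⟨J, hJ⟩ := J
  induction J using multiIndex_induction with
  | zero =>
    rw [iterPartial_zero]
    exact fun _ _ => rfl
  | step I i ih =>
    have h1 : ∑ j, (Pi.single i 1 : Fin m → ℕ) j = 1 := by simp
    have hI : ∑ j, I j ≤ l := by
      simp only [Pi.add_apply, Finset.sum_add_distrib, h1] at hJ
      omega
    exact (partialDeriv_iterPartial_eq_add_single hV hu I i).symm.trans
      ((partialDeriv_congr hV (ih (hI.trans (Nat.le_succ l))) i).trans (h ⟨I, hI⟩ i))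

end PartialDeriv

/-! ### Total derivatives along prolonged sections -/

section TotalDeriv

variable {m n : ℕ}

/-- The open set of jet coordinates of order `l` over a set `O` of coordinates `(x^i, u^α)`. -/
def jetDomain (l : ℕ) (O : Set ((Fin m → ℝ) × (Fin n → ℝ))) : Set (JetCoord m n l) :=
  {y | (y.1, fun α => y.2 α (MultiIdx.zero m l)) ∈ O}

theorem isOpen_jetDomain {l : ℕ} {O : Set ((Fin m → ℝ) × (Fin n → ℝ))} (hO : IsOpen O) :
    IsOpen (jetDomain l O) :=
  hO.preimage (by fun_prop)

/-- `G` is, over the open set `O` of coordinates `(x^i, u^α)`, a smooth function of finitely many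
jet coordinates. -/
def IsJetSmooth (O : Set ((Fin m → ℝ) × (Fin n → ℝ))) (G : JetFunction m n) : Prop :=
  ∃ (l : ℕ) (g : JetCoord m n l → ℝ), ContDiffOn ℝ ∞ g (jetDomain l O) ∧
    ∀ x u, (x, fun α => u α 0) ∈ O → G x u = g (x, fun α J => u α J.1)

variable {O : Set ((Fin m → ℝ) × (Fin n → ℝ))} {G : JetFunction m n} {l : ℕ}
  {g : JetCoord m n l → ℝ}

theorem totalDeriv_eq_fderiv (hO : IsOpen O) (hg : ContDiffOn ℝ ∞ g (jetDomain l O))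
    (hG : ∀ x u, (x, fun α => u α 0) ∈ O → G x u = g (x, fun α J => u α J.1)) (i : Fin m)
    {x : Fin m → ℝ} {u : Fin n → (Fin m → ℕ) → ℝ} (hx : (x, fun α => u α 0) ∈ O) :
    totalDeriv i G x u = fderiv ℝ g (x, fun α J => u α J.1)
      (Pi.single i 1, fun α J => u α (J.1 + Pi.single i 1)) := by
  unfold totalDeriv
  set y : JetCoord m n l := (x, fun α J => u α J.1) with hy
  set v : JetCoord m n l := (Pi.single i 1, fun α J => u α (J.1 + Pi.single i 1)) with hv
  have hyO : y ∈ jetDomain l O := hx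
  have hgd : HasFDerivAt g (fderiv ℝ g y) y :=
    ((hg.contDiffAt ((isOpen_jetDomain hO).mem_nhds hyO)).differentiableAt
      (by simp)).hasFDerivAt
  have hline : HasDerivAt (fun t : ℝ => y + t • v) v 0 := by
    simpa using ((hasDerivAt_id (0 : ℝ)).smul_const v).const_add y
  have hcomp : HasDerivAt (fun t : ℝ => g (y + t • v)) (fderiv ℝ g y v) 0 :=
    HasFDerivAt.comp_hasDerivAt (0 : ℝ) (by simpa using hgd) hline
  have hev : (fun t : ℝ => G (x + t • Pi.single i 1)
      (fun α J => u α J + t * u α (J + Pi.single i 1))) =ᶠ[𝓝 0] fun t => g (y + t • v) := by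
    have hc : Continuous fun t : ℝ => ((x + t • Pi.single i 1,
        fun α => u α 0 + t * u α (0 + Pi.single i 1)) : (Fin m → ℝ) × (Fin n → ℝ)) := by
      fun_prop
    have h0 : ∀ᶠ t : ℝ in 𝓝 0, ((x + t • Pi.single i 1,
        fun α => u α 0 + t * u α (0 + Pi.single i 1)) : (Fin m → ℝ) × (Fin n → ℝ)) ∈ O :=
      hc.continuousAt.eventually_mem (hO.mem_nhds (by simpa using hx))
    filter_upwards [h0] with t ht
    exact hG _ _ ht
  rw [hev.deriv_eq, hcomp.deriv]

theorem IsJetSmooth.totalDeriv (hO : IsOpen O) (hG : IsJetSmooth O G) (i : Fin m) :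
    IsJetSmooth O (totalDeriv i G) := by
  obtain ⟨l, g, hg, hG⟩ := hG
  refine ⟨l + 1, fun y => fderiv ℝ g (y.1, fun α J => y.2 α J.castSucc)
    (Pi.single i 1, fun α J => y.2 α (J.succ i)), ?_, fun x u hx =>
      totalDeriv_eq_fderiv hO hg hG i hx⟩
  have h1 : ContDiff ℝ ∞ fun y : JetCoord m n (l + 1) =>
      ((y.1, fun α J => y.2 α J.castSucc) : JetCoord m n l) := by fun_prop
  have h2 : ContDiff ℝ ∞ fun y : JetCoord m n (l + 1) =>
      ((Pi.single i 1, fun α J => y.2 α (J.succ i)) : JetCoord m n l) := by fun_prop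
  exact ((hg.fderiv_of_isOpen (isOpen_jetDomain hO) (m := ∞) (by simp)).comp h1.contDiffOn
    fun y hy => hy).clm_apply h2.contDiffOn

variable {V : Set (Fin m → ℝ)} {φ : Fin n → (Fin m → ℝ) → ℝ}

theorem partialDeriv_prolongation (hO : IsOpen O) (hV : IsOpen V)
    (hφ : ∀ α, ContDiffOn ℝ ∞ (φ α) V) (hφO : ∀ x ∈ V, (x, fun α => φ α x) ∈ O)
    (hG : IsJetSmooth O G) (i : Fin m) :
    Set.EqOn (partialDeriv i fun x => G x fun α J => iterPartial J (φ α) x)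
      (fun x => totalDeriv i G x fun α J => iterPartial J (φ α) x) V := by
  intro x hx
  obtain ⟨l, g, hg, hG⟩ := hG
  have hO' : ∀ x ∈ V, (x, fun α => iterPartial 0 (φ α) x) ∈ O := by
    simpa only [iterPartial_zero] using hφO
  simp only
  rw [totalDeriv_eq_fderiv hO hg hG i (hO' x hx)]
  set j : (Fin m → ℝ) → JetCoord m n l := fun x => (x, fun α J => iterPartial J.1 (φ α) x) with hj
  have hev : (fun x => G x fun α J => iterPartial J (φ α) x) =ᶠ[𝓝 x] g ∘ j := by
    filter_upwards [hV.mem_nhds hx] with z hz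
    exact hG _ _ (hO' z hz)
  have hgd : HasFDerivAt g (fderiv ℝ g (j x)) (j x) :=
    ((hg.contDiffAt ((isOpen_jetDomain hO).mem_nhds (hO' x hx))).differentiableAt
      (by simp)).hasFDerivAt
  have hjd : HasFDerivAt j ((ContinuousLinearMap.id ℝ (Fin m → ℝ)).prod
      (ContinuousLinearMap.pi fun α => ContinuousLinearMap.pi fun J : MultiIdx m l =>
        fderiv ℝ (iterPartial J.1 (φ α)) x)) x := by
    refine (hasFDerivAt_id x).prodMk (hasFDerivAt_pi.mpr fun α => hasFDerivAt_pi.mpr fun J => ?_)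
    exact (((contDiffOn_iterPartial hV (hφ α) J.1).contDiffAt (hV.mem_nhds hx)).differentiableAt
      (by simp)).hasFDerivAt
  unfold partialDeriv
  rw [hev.fderiv_eq, (hgd.comp x hjd).fderiv]
  simp only [ContinuousLinearMap.comp_apply]
  congr 1
  refine Prod.ext (by simp) ?_
  funext α J
  exact partialDeriv_iterPartial_eq_add_single hV (hφ α) J.1 i hx

/-- Iterated total derivatives, evaluated on the jets of a section, are the partial derivatives of
the function evaluated on the jets of the section. -/
theorem iterTotal_prolongation (hO : IsOpen O) (hV : IsOpen V)
    (hφ : ∀ α, ContDiffOn ℝ ∞ (φ α) V) (hφO : ∀ x ∈ V, (x, fun α => φ α x) ∈ O)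
    (hG : IsJetSmooth O G) (J : Fin m → ℕ) :
    Set.EqOn (fun x => iterTotal J G x fun α J => iterPartial J (φ α) x)
      (iterPartial J fun x => G x fun α J => iterPartial J (φ α) x) V :=
  (multiIterate_rel (D := totalDeriv) (D' := partialDeriv)
    (R := fun G f => IsJetSmooth O G ∧
      Set.EqOn (fun x => G x fun α J => iterPartial J (φ α) x) f V)
    (fun i _ _ h => ⟨h.1.totalDeriv hO i,
      (partialDeriv_prolongation hO hV hφ hφO h.1 i).symm.trans (partialDeriv_congr hV h.2 i)⟩)
    J ⟨hG, fun _ _ => rfl⟩).2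

end TotalDeriv

/-! ### Evaluation of the premultisymplectic form on a horizontal frame -/

section Wedge

variable {W : Type*} [AddCommGroup W] [Module ℝ W]

theorem wedge_apply {q : ℕ} (θ : Fin q → (W →ₗ[ℝ] ℝ)) (v : Fin q → W) :
    wedge θ v = (Matrix.of fun b a => θ a (v b)).det := rfl

theorem wedge_comp_perm {q : ℕ} (θ : Fin q → (W →ₗ[ℝ] ℝ)) (s : Equiv.Perm (Fin q))
    (v : Fin q → W) : wedge (θ ∘ s) v = (Equiv.Perm.sign s : ℤ) * wedge θ v := by
  rw [wedge_apply, wedge_apply, ← Matrix.det_permute']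
  rfl

variable {m : ℕ} {θ : Fin m → (W →ₗ[ℝ] ℝ)} {H : Fin m → W} {V : W}

theorem wedge_cons_cons (θ₀ : W →ₗ[ℝ] ℝ) (hV : ∀ j, θ j V = 0) :
    wedge (Fin.cons θ₀ θ : Fin (m + 1) → (W →ₗ[ℝ] ℝ)) (Fin.cons V H : Fin (m + 1) → W)
      = θ₀ V * wedge θ H := by
  rw [wedge_apply, wedge_apply, Matrix.det_succ_row_zero, Fin.sum_univ_succ]
  have h0 : ∀ j : Fin m, (Matrix.of fun b a => (Fin.cons θ₀ θ : Fin (m + 1) → (W →ₗ[ℝ] ℝ)) a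
      ((Fin.cons V H : Fin (m + 1) → W) b)) 0 j.succ = 0 := fun j => by simp [hV]
  simp only [h0, mul_zero, zero_mul, Finset.sum_const_zero, add_zero]
  simp only [Fin.val_zero, pow_zero, one_mul, Matrix.of_apply, Fin.cons_zero,
    Fin.succAbove_zero]
  rfl

theorem wedge_update_of_dual (hH : ∀ j b, θ j (H b) = if b = j then 1 else 0) (i : Fin m)
    (ξ : W →ₗ[ℝ] ℝ) : wedge (Function.update θ i ξ) H = ξ (H i) := by
  have : (Matrix.of fun b a => Function.update θ i ξ a (H b))
      = (1 : Matrix (Fin m) (Fin m) ℝ).updateCol i fun b => ξ (H b) := by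
    ext b a
    by_cases ha : a = i
    · subst ha
      simp
    · simp [ha, hH, Matrix.one_apply]
  rw [wedge_apply, this, ← Matrix.cramer_apply, Matrix.cramer_one]
  rfl

theorem wedge_of_dual (hH : ∀ j b, θ j (H b) = if b = j then 1 else 0) : wedge θ H = 1 := by
  have : (Matrix.of fun b a => θ a (H b)) = (1 : Matrix (Fin m) (Fin m) ℝ) := by
    ext b a
    simp [hH, Matrix.one_apply]
  rw [wedge_apply, this, Matrix.det_one]

/-- The form `ξ ∧ (θ₁ ∧ ⋯ ∧ ζ ∧ ⋯ ∧ θ_m)`, with `ζ` in place of `θ_i`, on a vector `V` that is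
annihilated by the `θ_j` and a frame dual to them. As `V` is annihilated by `ξ` or by `ζ`, the
expansion along `V` leaves a single minor. -/
theorem wedge_cons_update_cons (hH : ∀ j b, θ j (H b) = if b = j then 1 else 0)
    (hV : ∀ j, θ j V = 0) (i : Fin m) (ξ ζ : W →ₗ[ℝ] ℝ) (h : ξ V = 0 ∨ ζ V = 0) :
    wedge (Fin.cons ξ (Function.update θ i ζ) : Fin (m + 1) → (W →ₗ[ℝ] ℝ))
      (Fin.cons V H : Fin (m + 1) → W) = ξ V * ζ (H i) - ζ V * ξ (H i) := by
  have pure : ∀ ξ ζ : W →ₗ[ℝ] ℝ, ζ V = 0 →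
      wedge (Fin.cons ξ (Function.update θ i ζ) : Fin (m + 1) → (W →ₗ[ℝ] ℝ))
        (Fin.cons V H : Fin (m + 1) → W) = ξ V * ζ (H i) := by
    intro ξ ζ hζ
    rw [wedge_cons_cons, wedge_update_of_dual hH]
    intro j
    by_cases hj : j = i
    · subst hj
      simpa using hζ
    · simpa [hj] using hV j
  rcases h with h | h
  · -- Exchanging the covectors `ξ` and `ζ` changes the sign.
    have hs : (Fin.cons ξ (Function.update θ i ζ) : Fin (m + 1) → (W →ₗ[ℝ] ℝ))
        = (Fin.cons ζ (Function.update θ i ξ) : Fin (m + 1) → (W →ₗ[ℝ] ℝ)) ∘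
          Equiv.swap 0 i.succ := by
      funext a
      refine Fin.cases ?_ (fun j => ?_) a
      · simp
      · by_cases hj : j = i
        · subst hj
          simp only [Function.comp_apply, Equiv.swap_apply_right]
          simp only [Fin.cons_succ, Function.update_self, Fin.cons_zero]
        · have hne : j.succ ≠ i.succ := fun h => hj (Fin.succ_injective _ h)
          simp [Equiv.swap_apply_of_ne_of_ne (Fin.succ_ne_zero j) hne, hj]
    rw [hs, wedge_comp_perm, Equiv.Perm.sign_swap (Fin.succ_ne_zero i).symm, pure _ _ h, h]
    simp
  · rw [pure _ _ h, h]
    simp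

end Wedge

section Form

variable {m n r : ℕ}
  {M : Type*} [TopologicalSpace M] [ChartedSpace (EuclideanSpace ℝ (Fin m)) M]
  {E : Type*} [TopologicalSpace E] [ChartedSpace (EuclideanSpace ℝ (Fin (m + n))) E]
  {π : E → M}

/-- The value of `Ω_{H₀}` on a vertical vector, whose components along the jet coordinates or along
the momenta `p^{I,i}_α` vanish, and a frame that lifts `∂/∂x^1, …, ∂/∂x^m`. -/
theorem omegaH_cons (η : VolumeForm m M) (L : Jet m n π (r + 1) → ℝ) (e : AdaptedChart m n π)
    (y : WCoord m n r) {V : WCoord m n r} {H : Fin m → WCoord m n r} (hV : V.1 = 0)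
    (hVp : V.2.1 = 0 ∨ V.2.2.1 = 0) (hH : ∀ i, (H i).1 = Pi.single i 1) :
    omegaH η L e y (Fin.cons V H : Fin (m + 1) → WCoord m n r)
      = - V.2.2.2 - (∑ α, ∑ I : MultiIdx m r, ∑ i,
          (V.2.2.1 α I i * (H i).2.1 α I.castSucc - V.2.1 α I.castSucc * (H i).2.2.1 α I i))
        + density η.toFun e.base y.1 * fderiv ℝ (hamiltonian η L e) y V := by
  have hdual : ∀ j b, (dX j : WCoord m n r →ₗ[ℝ] ℝ) (H b) = if b = j then 1 else 0 := by
    intro j b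
    change (H b).1 j = _
    rw [hH, Pi.single_apply]
    simp [eq_comm]
  have hvert : ∀ j, (dX j : WCoord m n r →ₗ[ℝ] ℝ) V = 0 := fun j => by
    change V.1 j = 0
    rw [hV]
    rfl
  have hterm : ∀ α (I : MultiIdx m r) i,
      wedge (Fin.cons (dMom α I i) (Function.update dX i (dU α I.castSucc)) :
        Fin (m + 1) → (WCoord m n r →ₗ[ℝ] ℝ)) (Fin.cons V H : Fin (m + 1) → WCoord m n r)
      = V.2.2.1 α I i * (H i).2.1 α I.castSucc - V.2.1 α I.castSucc * (H i).2.2.1 α I i := by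
    intro α I i
    refine wedge_cons_update_cons hdual hvert i _ _ ?_
    rcases hVp with h | h
    · right
      change V.2.1 α I.castSucc = 0
      rw [h]
      rfl
    · left
      change V.2.2.1 α I i = 0
      rw [h]
      rfl
  have hsum : ∀ {κ : Type} (s : Finset κ)
      (A : κ → WCoord m n r [⋀^Fin (m + 1)]→ₗ[ℝ] ℝ) (v : Fin (m + 1) → WCoord m n r),
      (∑ a ∈ s, A a) v = ∑ a ∈ s, A a v := fun s A v =>
    map_sum (AddMonoidHom.mk' (fun B : WCoord m n r [⋀^Fin (m + 1)]→ₗ[ℝ] ℝ => B v)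
      fun _ _ => rfl) A s
  unfold omegaH
  simp only [AlternatingMap.add_apply, AlternatingMap.sub_apply, AlternatingMap.neg_apply,
    AlternatingMap.smul_apply, hsum, hterm, wedge_cons_cons _ hvert,
    wedge_of_dual hdual, mul_one, smul_eq_mul]
  rfl

variable {η : VolumeForm m M} {L : Jet m n π (r + 1) → ℝ} {e : AdaptedChart m n π}
  {y : WCoord m n r}

theorem fderiv_hamiltonian (hf : DifferentiableAt ℝ (density η.toFun e.base) y.1)
    (hf0 : density η.toFun e.base y.1 ≠ 0)
    (hL : DifferentiableAt ℝ (lagrangianRep L e) (y.1, y.2.1)) {V : WCoord m n r}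
    (hV : V.1 = 0) :
    fderiv ℝ (hamiltonian η L e) y V =
      ((∑ α, ∑ I : MultiIdx m r, ∑ i,
        (V.2.2.1 α I i * y.2.1 α (I.succ i) + y.2.2.1 α I i * V.2.1 α (I.succ i))) + V.2.2.2) /
          density η.toFun e.base y.1
        - fderiv ℝ (lagrangianRep L e) (y.1, y.2.1) (0, V.2.1) := by
  have hd : DifferentiableAt ℝ (hamiltonian η L e) y := by
    have h1 : DifferentiableAt ℝ (fun y : WCoord m n r => density η.toFun e.base y.1) y :=
      hf.comp y differentiableAt_fst
    have h2 : DifferentiableAt ℝ (fun y : WCoord m n r => lagrangianRep L e (y.1, y.2.1)) y :=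
      DifferentiableAt.comp (g := lagrangianRep L e)
        (f := fun y : WCoord m n r => (y.1, y.2.1)) y hL (by fun_prop)
    have h3 : DifferentiableAt ℝ (fun y : WCoord m n r =>
      (∑ α, ∑ I : MultiIdx m r, ∑ i, y.2.2.1 α I i * y.2.1 α (I.succ i)) + y.2.2.2) y := by
      fun_prop
    have h4 : DifferentiableAt ℝ (fun y : WCoord m n r => (density η.toFun e.base y.1)⁻¹) y :=
      h1.fun_inv hf0
    unfold hamiltonian
    simp only [div_eq_mul_inv]
    exact (h3.fun_mul h4).fun_sub h2
  have hline : HasDerivAt (fun t : ℝ => y + t • V) V 0 := by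
    simpa using ((hasDerivAt_id (0 : ℝ)).smul_const V).const_add y
  have hcomp : HasDerivAt (fun t : ℝ => hamiltonian η L e (y + t • V))
      (fderiv ℝ (hamiltonian η L e) y V) 0 :=
    HasFDerivAt.comp_hasDerivAt (l := hamiltonian η L e) (f := fun t : ℝ => y + t • V) (0 : ℝ)
      (by simpa using hd.hasFDerivAt) hline
  -- The density is constant along the line, since `V` is vertical.
  refine hcomp.unique ?_
  have hx : ∀ t : ℝ, (y + t • V).1 = y.1 := fun t => by simp [hV]
  simp only [hamiltonian, hx]
  refine HasDerivAt.sub (HasDerivAt.div_const (HasDerivAt.add ?_ ?_) _) ?_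
  · refine HasDerivAt.fun_sum fun α _ => HasDerivAt.fun_sum fun I _ => HasDerivAt.fun_sum
      fun i _ => ?_
    have hp : HasDerivAt (fun t : ℝ => (y + t • V).2.2.1 α I i) (V.2.2.1 α I i) 0 := by
      simpa using ((hasDerivAt_id (0 : ℝ)).mul_const (V.2.2.1 α I i)).const_add (y.2.2.1 α I i)
    have hu : HasDerivAt (fun t : ℝ => (y + t • V).2.1 α (I.succ i)) (V.2.1 α (I.succ i)) 0 := by
      simpa using ((hasDerivAt_id (0 : ℝ)).mul_const (V.2.1 α (I.succ i))).const_add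
        (y.2.1 α (I.succ i))
    simpa using hp.fun_mul hu
  · simpa using ((hasDerivAt_id (0 : ℝ)).mul_const V.2.2.2).const_add y.2.2.2
  · have hl : HasDerivAt (fun t : ℝ => ((y.1, (y + t • V).2.1) : JetCoord m n (r + 1)))
        (0, V.2.1) 0 := by
      refine (hasDerivAt_const _ _).prodMk ?_
      simpa using ((hasDerivAt_id (0 : ℝ)).smul_const V.2.1).const_add y.2.1
    have h0 : ((y.1, (y + (0 : ℝ) • V).2.1) : JetCoord m n (r + 1)) = (y.1, y.2.1) := by simp
    exact HasFDerivAt.comp_hasDerivAt (l := lagrangianRep L e)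
      (f := fun t : ℝ => ((y.1, (y + t • V).2.1) : JetCoord m n (r + 1))) (0 : ℝ)
      (by rw [h0]; exact hL.hasFDerivAt) hl

/-- The coefficient of `Ω_{H₀}` along `∂/∂p^{I,i}_α` makes the frame holonomic. -/
theorem jet_eq_of_omegaH_eq_zero (hf : DifferentiableAt ℝ (density η.toFun e.base) y.1)
    (hf0 : density η.toFun e.base y.1 ≠ 0)
    (hL : DifferentiableAt ℝ (lagrangianRep L e) (y.1, y.2.1)) {H : Fin m → WCoord m n r}
    (hH : ∀ i, (H i).1 = Pi.single i 1)
    (hΩ : ∀ V : WCoord m n r, V.1 = 0 →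
      omegaH η L e y (Fin.cons V H : Fin (m + 1) → WCoord m n r) = 0)
    (α : Fin n) (I : MultiIdx m r) (i : Fin m) :
    (H i).2.1 α I.castSucc = y.2.1 α (I.succ i) := by
  classical
  have h := hΩ (0, 0, Pi.single α (Pi.single I (Pi.single i 1)), 0) rfl
  rw [omegaH_cons η L e y rfl (Or.inl rfl) hH, fderiv_hamiltonian hf hf0 hL rfl] at h
  have hz : fderiv ℝ (lagrangianRep L e) (y.1, y.2.1)
      ((0, 0) : JetCoord m n (r + 1)) = 0 := map_zero _
  have hs : ∀ c : Fin n → MultiIdx m r → Fin m → ℝ, ∑ β, ∑ K, ∑ j,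
      (Pi.single α (Pi.single I (Pi.single i 1)) : Fin n → MultiIdx m r → Fin m → ℝ) β K j
        * c β K j = c α I i := by
    intro c
    rw [Finset.sum_eq_single α (fun β _ hβ => by simp [hβ]) (by simp),
      Finset.sum_eq_single I (fun K _ hK => by simp [hK]) (by simp),
      Finset.sum_eq_single i (fun j _ hj => by simp [hj]) (by simp)]
    simp
  simp only [Pi.zero_apply, zero_mul, mul_zero, sub_zero, add_zero, hs, hz, neg_zero, zero_sub]
    at h
  rw [mul_div_cancel₀ _ hf0] at h
  linarith

/-- The coefficient of `Ω_{H₀}` along `∂/∂u^α_J` gives the equations of the momenta. -/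
theorem momentum_eq_of_omegaH_eq_zero (hf : DifferentiableAt ℝ (density η.toFun e.base) y.1)
    (hf0 : density η.toFun e.base y.1 ≠ 0)
    (hL : DifferentiableAt ℝ (lagrangianRep L e) (y.1, y.2.1)) {H : Fin m → WCoord m n r}
    (hH : ∀ i, (H i).1 = Pi.single i 1)
    (hΩ : ∀ V : WCoord m n r, V.1 = 0 →
      omegaH η L e y (Fin.cons V H : Fin (m + 1) → WCoord m n r) = 0)
    (α : Fin n) (J : MultiIdx m (r + 1)) :
    fderiv ℝ (fun z : JetCoord m n (r + 1) => density η.toFun e.base z.1 * lagrangianRep L e z)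
        (y.1, y.2.1) (jetDu α J) =
      ∑ I : MultiIdx m r, ∑ i, ((if I.castSucc = J then (H i).2.2.1 α I i else 0)
        + (if I.succ i = J then y.2.2.1 α I i else 0)) := by
  classical
  have h := hΩ (0, Pi.single α (Pi.single J 1), 0, 0) rfl
  rw [omegaH_cons η L e y rfl (Or.inr rfl) hH, fderiv_hamiltonian hf hf0 hL rfl] at h
  have hprod : fderiv ℝ (fun z : JetCoord m n (r + 1) =>
      density η.toFun e.base z.1 * lagrangianRep L e z) (y.1, y.2.1) (jetDu α J)
      = density η.toFun e.base y.1 * fderiv ℝ (lagrangianRep L e) (y.1, y.2.1) (jetDu α J) := by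
    have hf1 : HasFDerivAt (fun z : JetCoord m n (r + 1) => density η.toFun e.base z.1)
        ((fderiv ℝ (density η.toFun e.base) y.1).comp (ContinuousLinearMap.fst ℝ _ _))
        (y.1, y.2.1) :=
      HasFDerivAt.comp (g := density η.toFun e.base) (y.1, y.2.1) hf.hasFDerivAt hasFDerivAt_fst
    rw [(hf1.fun_mul hL.hasFDerivAt).fderiv]
    simp [jetDu]
  have hs : ∀ (c : Fin n → MultiIdx m r → Fin m → ℝ)
      (K : MultiIdx m r → Fin m → MultiIdx m (r + 1)),
      ∑ β, ∑ I, ∑ j,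
        (Pi.single α (Pi.single J 1) : Fin n → MultiIdx m (r + 1) → ℝ) β (K I j) * c β I j
        = ∑ I, ∑ j, if K I j = J then c α I j else 0 := by
    intro c K
    rw [Finset.sum_eq_single α (fun β _ hβ => by simp [hβ]) (by simp)]
    refine Finset.sum_congr rfl fun I _ => Finset.sum_congr rfl fun j _ => ?_
    by_cases hK : K I j = J <;> simp [hK]
  have h1 := hs (fun β I j => (H j).2.2.1 β I j) (fun I _ => I.castSucc)
  have h2 := hs y.2.2.1 (fun I j => I.succ j)
  simp only [Pi.zero_apply, zero_mul, add_zero, zero_add, zero_sub, neg_zero,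
    Finset.sum_neg_distrib, sub_neg_eq_add, mul_comm (y.2.2.1 _ _ _), h1, h2] at h
  rw [hprod]
  simp only [Finset.sum_add_distrib]
  have h3 : fderiv ℝ (lagrangianRep L e) (y.1, y.2.1)
      ((0, Pi.single α (Pi.single J 1)) : JetCoord m n (r + 1))
      = fderiv ℝ (lagrangianRep L e) (y.1, y.2.1) (jetDu α J) := rfl
  rw [h3, mul_sub, mul_div_cancel₀ _ hf0] at h
  linarith

end Form

/-! ### Coordinates on the base, adapted charts and jets -/

section Geometry

variable {m n r l : ℕ}
  {M : Type*} [TopologicalSpace M] [ChartedSpace (EuclideanSpace ℝ (Fin m)) M]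
  {E : Type*} [TopologicalSpace E] [ChartedSpace (EuclideanSpace ℝ (Fin (m + n))) E]
  {π : E → M}

/-- A nonzero form of top degree does not vanish on the frame `∂/∂x^1, …, ∂/∂x^m`. -/
theorem density_ne_zero [IsManifold (𝓡 m) ∞ M] (η : VolumeForm m M)
    {c : OpenPartialHomeomorph M (Fin m → ℝ)} (hc : IsCoordinateSystem c) {x : Fin m → ℝ}
    (hx : x ∈ c.target) : density η.toFun c x ≠ 0 := by
  have hsymm : MDifferentiableAt 𝓘(ℝ, Fin m → ℝ) (𝓡 m) c.symm x :=
    ((hc.2.contMDiffAt (c.open_target.mem_nhds hx)).mdifferentiableAt (by simp))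
  have hchart : MDifferentiableAt (𝓡 m) 𝓘(ℝ, Fin m → ℝ) c (c.symm x) :=
    (hc.1.contMDiffAt (c.open_source.mem_nhds (c.map_target hx))).mdifferentiableAt (by simp)
  set D : (Fin m → ℝ) →L[ℝ] EuclideanSpace ℝ (Fin m) :=
    mfderiv 𝓘(ℝ, Fin m → ℝ) (𝓡 m) c.symm x with hD
  set D' : EuclideanSpace ℝ (Fin m) →L[ℝ] (Fin m → ℝ) :=
    mfderiv (𝓡 m) 𝓘(ℝ, Fin m → ℝ) c (c.symm x) with hD'
  have hinv : ∀ v, D' (D v) = v := by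
    intro v
    have hcomp : HasMFDerivAt 𝓘(ℝ, Fin m → ℝ) 𝓘(ℝ, Fin m → ℝ) (c ∘ c.symm) x (D'.comp D) :=
      HasMFDerivAt.comp x hchart.hasMFDerivAt hsymm.hasMFDerivAt
    have hid : HasMFDerivAt 𝓘(ℝ, Fin m → ℝ) 𝓘(ℝ, Fin m → ℝ) (c ∘ c.symm) x
        (ContinuousLinearMap.id ℝ (Fin m → ℝ)) := by
      refine (hasMFDerivAt_id x).congr_of_eventuallyEq ?_
      filter_upwards [c.open_target.mem_nhds hx] with z hz
      exact c.right_inv hz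
    exact DFunLike.congr_fun (hasMFDerivAt_unique hcomp hid) v
  have hinj : Function.Injective D.toLinearMap := Function.LeftInverse.injective hinv
  let b : Module.Basis (Fin m) ℝ (EuclideanSpace ℝ (Fin m)) :=
    (Pi.basisFun ℝ (Fin m)).map (LinearMap.linearEquivOfInjective D.toLinearMap hinj (by simp))
  have hb : ∀ i, b i = D (Pi.single i 1) := fun i => by simp [b]
  have hne : η.toFun (c.symm x) b ≠ 0 :=
    (AlternatingMap.map_basis_ne_zero_iff b _).mpr (η.ne_zero _)
  rwa [show (b : Fin m → EuclideanSpace ℝ (Fin m)) = fun i => D (Pi.single i 1) from funext hb]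
    at hne

/-- The local normal form of a submersion provides adapted charts. -/
theorem exists_adaptedChart [IsManifold (𝓡 m) ∞ M] [IsManifold (𝓡 (m + n)) ∞ E]
    (hπ : Manifold.IsSubmersion (𝓡 (m + n)) (𝓡 m) ∞ π) (y : E) :
    ∃ e : AdaptedChart m n π, y ∈ e.total.source := by
  have h := hπ.isSubmersionAt y
  have : FiniteDimensional ℝ (EuclideanSpace ℝ (Fin m) × h.complement) :=
    LinearEquiv.finiteDimensional h.equiv.toLinearEquiv
  have : FiniteDimensional ℝ h.complement :=
    Module.Finite.of_surjective (LinearMap.snd ℝ (EuclideanSpace ℝ (Fin m)) h.complement)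
      LinearMap.snd_surjective
  have hfin : Module.finrank ℝ h.complement = Module.finrank ℝ (Fin n → ℝ) := by
    have := h.equiv.toLinearEquiv.finrank_eq
    simp only [finrank_euclideanSpace, Fintype.card_fin, Module.finrank_prod] at this
    simp
    omega
  let A : EuclideanSpace ℝ (Fin m) ≃L[ℝ] (Fin m → ℝ) := EuclideanSpace.equiv (Fin m) ℝ
  let B : h.complement ≃L[ℝ] (Fin n → ℝ) := ContinuousLinearEquiv.ofFinrankEq hfin
  let T : EuclideanSpace ℝ (Fin (m + n)) ≃L[ℝ] (Fin m → ℝ) × (Fin n → ℝ) :=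
    h.equiv.trans (A.prodCongr B)
  refine ⟨{
    base := h.codChart.transHomeomorph A.toHomeomorph
    total := h.domChart.transHomeomorph T.toHomeomorph
    isCoordinateSystem_base := ⟨?_, ?_⟩
    smooth_total := ?_
    smooth_total_symm := ?_
    mapsTo := fun z hz => h.source_subset_preimage_source hz
    fst_total := fun z hz => ?_ }, h.mem_domChart_source⟩
  · exact A.contDiff.contMDiff.comp_contMDiffOn
      (contMDiffOn_of_mem_maximalAtlas h.codChart_mem_maximalAtlas)
  · exact (contMDiffOn_symm_of_mem_maximalAtlas h.codChart_mem_maximalAtlas).comp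
      A.symm.contDiff.contMDiff.contMDiffOn fun z hz => hz
  · exact T.contDiff.contMDiff.comp_contMDiffOn
      (contMDiffOn_of_mem_maximalAtlas h.domChart_mem_maximalAtlas)
  · exact (contMDiffOn_symm_of_mem_maximalAtlas h.domChart_mem_maximalAtlas).comp
      T.symm.contDiff.contMDiff.contMDiffOn fun z hz => hz
  · have hz' : z ∈ h.domChart.source := hz
    have hmem : h.domChart z ∈ (h.domChart.extend (𝓡 (m + n))).target := by
      simpa using h.domChart.map_source hz'
    have hw := h.writtenInCharts hmem
    have hw' : h.codChart (π z) = (h.equiv (h.domChart z)).1 := by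
      simpa [h.domChart.left_inv hz'] using hw
    change A (h.equiv (h.domChart z)).1 = A (h.codChart (π z))
    rw [hw']

theorem PointedSection.proj_toFun_pt (s : PointedSection m n π) : π (s.toFun s.pt) = s.pt :=
  s.isLocalSection.self_of_nhds.1

theorem Jet.proj_value (z : Jet m n π l) : π z.value = z.pt := by
  induction z using Quotient.inductionOn with
  | h s => exact s.proj_toFun_pt

theorem Jet.value_proj (z : Jet m n π (l + 1)) : z.proj.value = z.value := by
  induction z using Quotient.inductionOn with
  | h s => rfl

theorem PointedSection.coord_mk {s : PointedSection m n π} {e : AdaptedChart m n π}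
    (hs : s.toFun s.pt ∈ e.total.source) :
    Jet.coord e (Quotient.mk (jetSetoid m n π l) s) = s.coords l e :=
  if_pos hs

/-- The coordinates of order zero of a jet are the coordinates of its value. -/
theorem Jet.coord_zero {z : Jet m n π l} {e : AdaptedChart m n π} (hz : z ∈ Jet.domain e) :
    ((z.coord e).1, fun α => (z.coord e).2 α (MultiIdx.zero m l)) = e.total z.value := by
  induction z using Quotient.inductionOn with
  | h s =>
    have hs : s.toFun s.pt ∈ e.total.source := hz
    rw [PointedSection.coord_mk hs]
    have hpt : e.base s.pt = (e.total (s.toFun s.pt)).1 := by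
      rw [e.fst_total _ hs, s.proj_toFun_pt]
    have hsrc : s.pt ∈ e.base.source := by
      rw [← s.proj_toFun_pt]
      exact e.mapsTo _ hs
    refine Prod.ext hpt ?_
    funext α
    change iterPartial 0 (e.sectionRep s.toFun α) (e.base s.pt) = _
    rw [iterPartial_zero, AdaptedChart.sectionRep, e.base.left_inv hsrc]
    rfl

theorem MixedSpace.mem_domain_iff {w : MixedSpace m n π r} {e : AdaptedChart m n π} :
    w ∈ MixedSpace.domain e ↔ w.value ∈ e.total.source := by
  change w.jet.proj.value ∈ e.total.source ↔ w.jet.value ∈ e.total.source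
  rw [Jet.value_proj]

theorem MixedSpace.jetCoord_coord {w : MixedSpace m n π r} {e : AdaptedChart m n π}
    (hw : w ∈ MixedSpace.domain e) :
    (((MixedSpace.coord e w).1, (MixedSpace.coord e w).2.1) : JetCoord m n (r + 1))
      = w.jet.coord e := by
  rw [MixedSpace.coord, dif_pos hw]

theorem MixedSpace.pt_mem_source {w : MixedSpace m n π r} {e : AdaptedChart m n π}
    (hw : w ∈ MixedSpace.domain e) : w.pt ∈ e.base.source := by
  have := e.mapsTo _ (MixedSpace.mem_domain_iff.mp hw)
  rwa [show π w.value = w.pt from w.jet.proj_value] at this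

end Geometry

/-! ### Integral sections in coordinates -/

section Section

variable {m n r : ℕ}
  {M : Type*} [TopologicalSpace M] [ChartedSpace (EuclideanSpace ℝ (Fin m)) M]
  {E : Type*} [TopologicalSpace E] [ChartedSpace (EuclideanSpace ℝ (Fin (m + n))) E]
  {π : E → M} {σ : M → MixedSpace m n π r} {U : Set M}

/-- The set of the coordinates of the points of `U` whose image under `σ` lies in the domain of an
adapted chart. -/
def sectionDomain (σ : M → MixedSpace m n π r) (U : Set M) (e : AdaptedChart m n π) :
    Set (Fin m → ℝ) :=
  e.base.target ∩ e.base.symm ⁻¹' {x | x ∈ U ∧ σ x ∈ MixedSpace.domain e}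

variable {e : AdaptedChart m n π}

theorem isOpen_sectionDomain (hU : IsOpen U) (hσ : IsSmoothSectionOn σ U) :
    IsOpen (sectionDomain σ U e) := by
  refine e.base.symm.isOpen_inter_preimage (isOpen_iff_eventually.mpr ?_)
  rintro x ⟨hxU, hxe⟩
  exact (hU.eventually_mem hxU).and ((hσ x hxU).2 e hxe).1

theorem mem_base_source (hσ : IsSmoothSectionOn σ U) {x : M} (hx : x ∈ U)
    (hxe : σ x ∈ MixedSpace.domain e) : x ∈ e.base.source := by
  have := MixedSpace.pt_mem_source hxe
  rwa [(hσ x hx).1] at this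

theorem base_mem_sectionDomain (hσ : IsSmoothSectionOn σ U) {x : M} (hx : x ∈ U)
    (hxe : σ x ∈ MixedSpace.domain e) : e.base x ∈ sectionDomain σ U e := by
  have hs := mem_base_source hσ hx hxe
  refine ⟨e.base.map_source hs, ?_⟩
  change e.base.symm (e.base x) ∈ U ∧ σ (e.base.symm (e.base x)) ∈ MixedSpace.domain e
  rw [e.base.left_inv hs]
  exact ⟨hx, hxe⟩

theorem contDiffOn_mixedRep (hσ : IsSmoothSectionOn σ U) :
    ContDiffOn ℝ ∞ (mixedRep σ e) (sectionDomain σ U e) := by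
  intro x hx
  have h := ((hσ _ hx.2.1).2 e hx.2.2).2
  rw [e.base.right_inv hx.1] at h
  exact h.contDiffWithinAt

theorem mixedRep_zero {x : Fin m → ℝ} (hx : x ∈ sectionDomain σ U e) :
    (((mixedRep σ e x).1, fun α => (mixedRep σ e x).2.1 α (MultiIdx.zero m (r + 1))) :
      (Fin m → ℝ) × (Fin n → ℝ)) = e.total (σ (e.base.symm x)).value := by
  have hjet := MixedSpace.jetCoord_coord hx.2.2
  rw [← show _ = e.total (σ (e.base.symm x)).value from
    Jet.coord_zero (MixedSpace.mem_domain_iff.mp hx.2.2), ← hjet]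
  rfl

theorem mixedRep_zero_mem_target {x : Fin m → ℝ} (hx : x ∈ sectionDomain σ U e) :
    (((mixedRep σ e x).1, fun α => (mixedRep σ e x).2.1 α (MultiIdx.zero m (r + 1))) :
      (Fin m → ℝ) × (Fin n → ℝ)) ∈ e.total.target := by
  rw [mixedRep_zero hx]
  exact e.total.map_source (MixedSpace.mem_domain_iff.mp hx.2.2)

theorem mixedRep_fst (hσ : IsSmoothSectionOn σ U) {x : Fin m → ℝ}
    (hx : x ∈ sectionDomain σ U e) : (mixedRep σ e x).1 = x := by
  have h1 : (mixedRep σ e x).1 = (e.total (σ (e.base.symm x)).value).1 :=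
    congrArg Prod.fst (mixedRep_zero hx)
  rw [h1, e.fst_total _ (MixedSpace.mem_domain_iff.mp hx.2.2),
    show π (σ (e.base.symm x)).value = (σ (e.base.symm x)).pt from Jet.proj_value _,
    (hσ _ hx.2.1).1, e.base.right_inv hx.1]

theorem mixedRep_zero_eq_sectionRep {x : Fin m → ℝ} (hx : x ∈ sectionDomain σ U e)
    (α : Fin n) : (mixedRep σ e x).2.1 α (MultiIdx.zero m (r + 1))
      = e.sectionRep (fun y => (σ y).value) α x :=
  congrFun (congrArg Prod.snd (mixedRep_zero hx)) α

theorem fderiv_mixedRep_fst (hU : IsOpen U) (hσ : IsSmoothSectionOn σ U) {x : Fin m → ℝ}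
    (hx : x ∈ sectionDomain σ U e) (v : Fin m → ℝ) :
    (fderiv ℝ (mixedRep σ e) x v).1 = v := by
  have hV := (isOpen_sectionDomain (e := e) hU hσ).mem_nhds hx
  have hd : DifferentiableAt ℝ (mixedRep σ e) x :=
    ((contDiffOn_mixedRep hσ).contDiffAt hV).differentiableAt (by simp)
  have h1 : HasFDerivAt (fun z => (mixedRep σ e z).1) _ x := hd.hasFDerivAt.fst
  have h2 : HasFDerivAt (fun z => (mixedRep σ e z).1) (ContinuousLinearMap.id ℝ (Fin m → ℝ)) x := by
    refine (hasFDerivAt_id x).congr_of_eventuallyEq ?_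
    filter_upwards [hV] with z hz
    exact mixedRep_fst hσ hz
  exact DFunLike.congr_fun (h1.unique h2) v

/-- A horizontal projector that solves the dynamical equation annihilates `Ω_{H₀}` on a vertical
vector and a frame of horizontal vectors. -/
theorem TangentEnd.omegaH_eq_zero {w : MixedSpace m n π r} {h : TangentEnd w} {η : VolumeForm m M}
    {L : Jet m n π (r + 1) → ℝ} (hp : h.IsHorizontalProjector) (hs : h.SolvesDynamicalEq η L)
    (he : w ∈ MixedSpace.domain e) {H : Fin m → WCoord m n r}
    (hH : ∀ i, h.comp e he (H i) = H i) {V : WCoord m n r} (hV : V.1 = 0) :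
    omegaH η L e (MixedSpace.coord e w) (Fin.cons V H : Fin (m + 1) → WCoord m n r) = 0 := by
  have h1 := hs e he (Fin.cons V H : Fin (m + 1) → WCoord m n r)
  rw [Fin.sum_univ_succ] at h1
  have h0 : omegaH η L e (MixedSpace.coord e w) (Function.update
      (Fin.cons V H : Fin (m + 1) → WCoord m n r) 0 (h.comp e he V)) = 0 := by
    refine AlternatingMap.map_coord_zero _ (0 : Fin (m + 1)) ?_
    simpa using ((hp e he).2 V).mpr hV
  have hi : ∀ i : Fin m, Function.update (Fin.cons V H : Fin (m + 1) → WCoord m n r) i.succ (H i)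
      = Fin.cons V H := fun i => by
    have : H i = (Fin.cons V H : Fin (m + 1) → WCoord m n r) i.succ := rfl
    conv_lhs => rw [this]
    exact Function.update_eq_self _ _
  simp only [Fin.cons_zero, Fin.cons_succ, hH, hi, h0, Finset.sum_const, Finset.card_univ,
    Fintype.card_fin, nsmul_eq_mul, zero_add] at h1
  linarith

variable {h : ∀ w : MixedSpace m n π r, TangentEnd w}

/-- The derivative of an integral section takes values in the horizontal space, hence is fixed by
the horizontal projector. -/
theorem comp_fderiv_mixedRep (hint : IsIntegralSectionOn h σ U)
    {x : Fin m → ℝ} (hx : x ∈ sectionDomain σ U e)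
    (hp : (h (σ (e.base.symm x))).IsHorizontalProjector) (v : Fin m → ℝ) :
    (h (σ (e.base.symm x))).comp e hx.2.2 (fderiv ℝ (mixedRep σ e) x v)
      = fderiv ℝ (mixedRep σ e) x v := by
  have hr := hint _ hx.2.1 e hx.2.2
  rw [e.base.right_inv hx.1] at hr
  have hmem : fderiv ℝ (mixedRep σ e) x v ∈
      ((h (σ (e.base.symm x))).comp e hx.2.2).range := by
    rw [← hr]
    exact ⟨v, rfl⟩
  obtain ⟨z, hz⟩ := hmem
  rw [← hz]
  exact DFunLike.congr_fun (hp e hx.2.2).1 z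

variable [IsManifold (𝓡 m) ∞ M] {η : VolumeForm m M} {L : Jet m n π (r + 1) → ℝ}

/-- The coordinates of an integral section: the jet coordinates of positive order are the
derivatives of those of the preceding order, and the momenta satisfy
`∂p^{J,i}_α/∂x^i + ∑_{I+1_i=J} p^{I,i}_α = ∂(fL)/∂u^α_J`. -/
theorem integralSection_equations (hL : IsSmoothLagrangian L) (hU : IsOpen U)
    (hσ : IsSmoothSectionOn σ U) (hint : IsIntegralSectionOn h σ U)
    (hp : ∀ x ∈ U, (h (σ x)).IsHorizontalProjector)
    (hs : ∀ x ∈ U, (h (σ x)).SolvesDynamicalEq η L)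
    {x : Fin m → ℝ} (hx : x ∈ sectionDomain σ U e) (α : Fin n) :
    (∀ (I : MultiIdx m r) (i : Fin m),
      partialDeriv i (fun z => (mixedRep σ e z).2.1 α I.castSucc) x
        = (mixedRep σ e x).2.1 α (I.succ i)) ∧
    ∀ J : MultiIdx m (r + 1),
      fderiv ℝ (fun z : JetCoord m n (r + 1) => density η.toFun e.base z.1 * lagrangianRep L e z)
        (x, (mixedRep σ e x).2.1) (jetDu α J) =
      ∑ I : MultiIdx m r, ∑ i,
        ((if I.castSucc = J then partialDeriv i (fun z => (mixedRep σ e z).2.2.1 α I i) x else 0)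
          + (if I.succ i = J then (mixedRep σ e x).2.2.1 α I i else 0)) := by
  have hV := (isOpen_sectionDomain (e := e) hU hσ).mem_nhds hx
  have hd : DifferentiableAt ℝ (mixedRep σ e) x :=
    ((contDiffOn_mixedRep hσ).contDiffAt hV).differentiableAt (by simp)
  have hfst := mixedRep_fst hσ hx
  set y := mixedRep σ e x with hy
  have hf : DifferentiableAt ℝ (density η.toFun e.base) y.1 := by
    rw [hfst]
    exact ((η.smooth e.base e.isCoordinateSystem_base).contDiffAt
      (e.base.open_target.mem_nhds hx.1)).differentiableAt (by simp)
  have hf0 : density η.toFun e.base y.1 ≠ 0 := by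
    rw [hfst]
    exact density_ne_zero η e.isCoordinateSystem_base hx.1
  have hLd : DifferentiableAt ℝ (lagrangianRep L e) (y.1, y.2.1) :=
    ((hL e).contDiffAt ((isOpen_jetDomain e.total.open_target).mem_nhds
      (mixedRep_zero_mem_target hx))).differentiableAt (by simp)
  set H : Fin m → WCoord m n r := fun i => fderiv ℝ (mixedRep σ e) x (Pi.single i 1) with hHdef
  have hH : ∀ i, (H i).1 = Pi.single i 1 := fun i => fderiv_mixedRep_fst hU hσ hx _
  have hΩ : ∀ V : WCoord m n r, V.1 = 0 →
      omegaH η L e y (Fin.cons V H : Fin (m + 1) → WCoord m n r) = 0 := fun V hV =>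
    TangentEnd.omegaH_eq_zero (hp _ hx.2.1) (hs _ hx.2.1) hx.2.2
      (fun i => comp_fderiv_mixedRep hint hx (hp _ hx.2.1) _) hV
  have hu : ∀ (J : MultiIdx m (r + 1)) i,
      partialDeriv i (fun z => (mixedRep σ e z).2.1 α J) x = (H i).2.1 α J := by
    intro J i
    have h1 : HasFDerivAt (fun z => (mixedRep σ e z).2.1 α J) _ x :=
      hasFDerivAt_pi'.mp (hasFDerivAt_pi'.mp hd.hasFDerivAt.snd.fst α) J
    rw [partialDeriv, h1.fderiv]
    rfl
  have hq : ∀ (I : MultiIdx m r) i,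
      partialDeriv i (fun z => (mixedRep σ e z).2.2.1 α I i) x = (H i).2.2.1 α I i := by
    intro I i
    have h1 : HasFDerivAt (fun z => (mixedRep σ e z).2.2.1 α I i) _ x :=
      hasFDerivAt_pi'.mp (hasFDerivAt_pi'.mp
        (hasFDerivAt_pi'.mp hd.hasFDerivAt.snd.snd.fst α) I) i
    rw [partialDeriv, h1.fderiv]
    rfl
  refine ⟨fun I i => ?_, fun J => ?_⟩
  · rw [hu]
    exact jet_eq_of_omegaH_eq_zero hf hf0 hLd hH hΩ α I i
  · have := momentum_eq_of_omegaH_eq_zero hf hf0 hLd hH hΩ α J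
    simp only [hq]
    rw [← this, hfst]

end Section

/-! ### Holonomy and the Euler–Lagrange equations -/

section Momenta

variable {m l : ℕ} {V : Set (Fin m → ℝ)}

theorem iterPartial_add {f g : (Fin m → ℝ) → ℝ} (hV : IsOpen V) (hf : ContDiffOn ℝ ∞ f V)
    (hg : ContDiffOn ℝ ∞ g V) (J : Fin m → ℕ) :
    Set.EqOn (iterPartial J fun x => f x + g x) (fun x => iterPartial J f x + iterPartial J g x)
      V := by
  have h := iterPartial_finset_sum hV (Finset.univ : Finset Bool) (F := fun b => cond b f g)
    (fun b _ => by cases b <;> assumption) J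
  simpa using h

theorem iterPartial_ite (c : Prop) [Decidable c] {f : (Fin m → ℝ) → ℝ} (hV : IsOpen V)
    (J : Fin m → ℕ) :
    Set.EqOn (iterPartial J fun x => if c then f x else 0)
      (fun x => if c then iterPartial J f x else 0) V := by
  by_cases hc : c
  · simp [hc, Set.EqOn]
  · simpa [hc] using iterPartial_finset_sum hV (∅ : Finset Unit) (F := fun _ => f) (by simp) J

theorem MultiIdx.sum_succ (I : MultiIdx m l) (i : Fin m) :
    ∑ j, (I.succ i).1 j = (∑ j, I.1 j) + 1 := by
  have h : ∑ j, (Pi.single i 1 : Fin m → ℕ) j = 1 := by simp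
  change ∑ j, (I.1 + Pi.single i 1 : Fin m → ℕ) j = _
  simp only [Pi.add_apply, Finset.sum_add_distrib, h]

/-- The momenta drop out of the alternating sum of the derivatives of the momentum equations: each
`p^{I,i}` contributes `∂^{I+1_i} p^{I,i}` twice, with the signs `(-1)^{|I|}` and
`(-1)^{|I|+1}`. -/
theorem sum_iterPartial_momenta_eq_zero (hV : IsOpen V)
    {P : MultiIdx m l → Fin m → (Fin m → ℝ) → ℝ} (hP : ∀ I i, ContDiffOn ℝ ∞ (P I i) V)
    {x : Fin m → ℝ} (hx : x ∈ V) :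
    ∑ J : MultiIdx m (l + 1), (-1 : ℝ) ^ (∑ i, J.1 i) *
      iterPartial J.1 (fun z => ∑ I : MultiIdx m l, ∑ i,
        ((if I.castSucc = J then partialDeriv i (P I i) z else 0)
          + (if I.succ i = J then P I i z else 0))) x = 0 := by
  have hsmooth₁ : ∀ J (I : MultiIdx m l) i,
      ContDiffOn ℝ ∞ (fun z => if I.castSucc = J then partialDeriv i (P I i) z else 0) V := by
    intro J I i
    split_ifs
    exacts [contDiffOn_partialDeriv hV (hP I i) i, contDiffOn_const]
  have hsmooth₂ : ∀ J (I : MultiIdx m l) i,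
      ContDiffOn ℝ ∞ (fun z => if I.succ i = J then P I i z else 0) V := by
    intro J I i
    split_ifs
    exacts [hP I i, contDiffOn_const]
  have hexp : ∀ J : MultiIdx m (l + 1),
      iterPartial J.1 (fun z => ∑ I : MultiIdx m l, ∑ i,
        ((if I.castSucc = J then partialDeriv i (P I i) z else 0)
          + (if I.succ i = J then P I i z else 0))) x
      = ∑ I : MultiIdx m l, ∑ i,
        ((if I.castSucc = J then iterPartial J.1 (partialDeriv i (P I i)) x else 0)
          + (if I.succ i = J then iterPartial J.1 (P I i) x else 0)) := by
    intro J
    rw [iterPartial_finset_sum hV _ (fun I _ => ContDiffOn.sum fun i _ =>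
      (hsmooth₁ J I i).add (hsmooth₂ J I i)) J.1 hx]
    refine Finset.sum_congr rfl fun I _ => ?_
    rw [iterPartial_finset_sum hV _ (fun i _ => (hsmooth₁ J I i).add (hsmooth₂ J I i)) J.1 hx]
    refine Finset.sum_congr rfl fun i _ => ?_
    exact (iterPartial_add hV (hsmooth₁ J I i) (hsmooth₂ J I i) J.1 hx).trans
      (congrArg₂ (· + ·) (iterPartial_ite _ hV J.1 hx) (iterPartial_ite _ hV J.1 hx))
  simp only [hexp, Finset.mul_sum]
  rw [Finset.sum_comm]
  refine Finset.sum_eq_zero fun I _ => ?_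
  rw [Finset.sum_comm]
  refine Finset.sum_eq_zero fun i _ => ?_
  simp only [mul_add, mul_ite, mul_zero, Finset.sum_add_distrib, Finset.sum_ite_eq,
    Finset.mem_univ, if_true, MultiIdx.sum_succ]
  have h : iterPartial I.castSucc.1 (partialDeriv i (P I i)) x
      = iterPartial (I.succ i).1 (P I i) x :=
    (partialDeriv_iterPartial hV (hP I i) I.1 i hx).symm.trans
      (partialDeriv_iterPartial_eq_add_single hV (hP I i) I.1 i hx)
  rw [h, show ∑ j, I.castSucc.1 j = ∑ j, I.1 j from rfl, pow_succ]
  ring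

end Momenta

section Solution

variable {m n r : ℕ}
  {M : Type*} [TopologicalSpace M] [ChartedSpace (EuclideanSpace ℝ (Fin m)) M]
  {E : Type*} [TopologicalSpace E] [ChartedSpace (EuclideanSpace ℝ (Fin (m + n))) E]
  {π : E → M} {σ : M → MixedSpace m n π r} {U : Set M} {e : AdaptedChart m n π}

theorem contDiffOn_sectionRep (hσ : IsSmoothSectionOn σ U) (α : Fin n) :
    ContDiffOn ℝ ∞ (e.sectionRep (fun y => (σ y).value) α) (sectionDomain σ U e) := by
  have h : ContDiff ℝ ∞ fun w : WCoord m n r => w.2.1 α (MultiIdx.zero m (r + 1)) := by fun_prop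
  exact (h.comp_contDiffOn (contDiffOn_mixedRep hσ)).congr fun x hx =>
    (mixedRep_zero_eq_sectionRep hx α).symm

theorem isLocalSectionAt_value [IsManifold (𝓡 m) ∞ M] [IsManifold (𝓡 (m + n)) ∞ E]
    (hπ : Manifold.IsSubmersion (𝓡 (m + n)) (𝓡 m) ∞ π) (hU : IsOpen U)
    (hσ : IsSmoothSectionOn σ U) {x : M} (hx : x ∈ U) :
    IsLocalSectionAt m n π (fun y => (σ y).value) x := by
  filter_upwards [hU.mem_nhds hx] with y hy
  refine ⟨(Jet.proj_value _).trans (hσ y hy).1, ?_⟩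
  obtain ⟨e, he⟩ := exists_adaptedChart hπ (σ y).value
  have hye : σ y ∈ MixedSpace.domain e := MixedSpace.mem_domain_iff.mpr he
  have hsrc := mem_base_source hσ hy hye
  have hmem := base_mem_sectionDomain hσ hy hye
  -- The section is recovered from its coordinates through the inverse of the chart.
  let q : WCoord m n r → (Fin m → ℝ) × (Fin n → ℝ) :=
    fun w => (w.1, fun α => w.2.1 α (MultiIdx.zero m (r + 1)))
  have hq : ContDiff ℝ ∞ q := by
    unfold q
    fun_prop
  have hrep : ContMDiffAt 𝓘(ℝ, Fin m → ℝ) 𝓘(ℝ, (Fin m → ℝ) × (Fin n → ℝ)) ∞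
      (q ∘ mixedRep σ e) (e.base y) :=
    (hq.comp_contDiffOn (contDiffOn_mixedRep hσ)).contDiffAt
      ((isOpen_sectionDomain hU hσ).mem_nhds hmem) |>.contMDiffAt
  have hbase : ContMDiffAt (𝓡 m) 𝓘(ℝ, Fin m → ℝ) ∞ e.base y :=
    e.isCoordinateSystem_base.1.contMDiffAt (e.base.open_source.mem_nhds hsrc)
  have htotal : ContMDiffAt 𝓘(ℝ, (Fin m → ℝ) × (Fin n → ℝ)) (𝓡 (m + n)) ∞ e.total.symm
      ((q ∘ mixedRep σ e) (e.base y)) :=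
    e.smooth_total_symm.contMDiffAt (e.total.open_target.mem_nhds (mixedRep_zero_mem_target hmem))
  refine (ContMDiffAt.comp y htotal (hrep.comp y hbase)).congr_of_eventuallyEq ?_
  filter_upwards [hU.mem_nhds hy, ((hσ y hy).2 e hye).1] with z hz hze
  have hzmem := base_mem_sectionDomain hσ hz hze
  have hval : q (mixedRep σ e (e.base z)) = e.total (σ (e.base.symm (e.base z))).value :=
    mixedRep_zero hzmem
  rw [e.base.left_inv (mem_base_source hσ hz hze)] at hval
  simp only [Function.comp_apply, hval]
  exact (e.total.left_inv (MixedSpace.mem_domain_iff.mp hze)).symm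

theorem contDiffOn_density_mul_lagrangianRep {η : VolumeForm m M}
    {L : Jet m n π (r + 1) → ℝ} (hL : IsSmoothLagrangian L) :
    ContDiffOn ℝ ∞
      (fun y : JetCoord m n (r + 1) => density η.toFun e.base y.1 * lagrangianRep L e y)
      (jetDomain (r + 1) e.total.target) := by
  refine ContDiffOn.mul ?_ (hL e)
  refine (η.smooth e.base e.isCoordinateSystem_base).comp contDiff_fst.contDiffOn fun y hy => ?_
  have hsrc := e.total.map_target hy
  have h1 := e.fst_total _ hsrc
  rw [e.total.right_inv hy] at h1
  change y.1 ∈ e.base.target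
  rw [show y.1 = _ from h1]
  exact e.base.map_source (e.mapsTo _ hsrc)

variable [IsManifold (𝓡 m) ∞ M] {h : ∀ w : MixedSpace m n π r, TangentEnd w}
  {η : VolumeForm m M} {L : Jet m n π (r + 1) → ℝ}

/-- The jet coordinates of an integral section are the derivatives of the underlying section. -/
theorem mixedRep_eq_iterPartial (hL : IsSmoothLagrangian L) (hU : IsOpen U)
    (hσ : IsSmoothSectionOn σ U) (hint : IsIntegralSectionOn h σ U)
    (hp : ∀ x ∈ U, (h (σ x)).IsHorizontalProjector)
    (hs : ∀ x ∈ U, (h (σ x)).SolvesDynamicalEq η L) (α : Fin n) (J : MultiIdx m (r + 1)) :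
    Set.EqOn (iterPartial J.1 (e.sectionRep (fun y => (σ y).value) α))
      (fun x => (mixedRep σ e x).2.1 α J) (sectionDomain σ U e) := by
  have hV := isOpen_sectionDomain (e := e) hU hσ
  have h0 : ContDiff ℝ ∞ fun w : WCoord m n r => w.2.1 α (MultiIdx.zero m (r + 1)) := by fun_prop
  refine (iterPartial_congr hV (fun x hx => (mixedRep_zero_eq_sectionRep hx α).symm) J.1).trans ?_
  exact iterPartial_eq_of_partialDeriv_eq (u := fun J x => (mixedRep σ e x).2.1 α J) hV
    (h0.comp_contDiffOn (contDiffOn_mixedRep hσ))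
    (fun I i x hx => (integralSection_equations hL hU hσ hint hp hs hx α).1 I i) J

/-- An integral section of a solution of the dynamical equation is holonomic. -/
theorem jet_eq_mk_value (hL : IsSmoothLagrangian L) (hU : IsOpen U)
    (hσ : IsSmoothSectionOn σ U) (hint : IsIntegralSectionOn h σ U)
    (hp : ∀ x ∈ U, (h (σ x)).IsHorizontalProjector)
    (hs : ∀ x ∈ U, (h (σ x)).SolvesDynamicalEq η L) {x : M} (hx : x ∈ U)
    (hloc : IsLocalSectionAt m n π (fun y => (σ y).value) x) :
    (σ x).jet = Jet.mk (r + 1) x (fun y => (σ y).value) hloc := by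
  obtain ⟨s, hsx⟩ := Quotient.exists_rep (σ x).jet
  have hpt : s.pt = x := by
    rw [← (hσ x hx).1]
    exact congrArg Jet.pt hsx
  have hval : s.toFun s.pt = (σ x).value := congrArg Jet.value hsx
  rw [← hsx]
  refine Quotient.sound ⟨hpt, hval, fun e he => ?_⟩
  have hxe : σ x ∈ MixedSpace.domain e := MixedSpace.mem_domain_iff.mpr (hval ▸ he)
  have hmem := base_mem_sectionDomain hσ hx hxe
  have hrep : mixedRep σ e (e.base x) = MixedSpace.coord e (σ x) := by
    rw [mixedRep, e.base.left_inv (mem_base_source hσ hx hxe)]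
  rw [← PointedSection.coord_mk he, hsx, ← MixedSpace.jetCoord_coord hxe, ← hrep]
  refine Prod.ext (mixedRep_fst hσ hmem) ?_
  funext α J
  exact (mixedRep_eq_iterPartial hL hU hσ hint hp hs α J hmem).symm

/-- The section underlying an integral section satisfies the Euler–Lagrange equations. -/
theorem eulerLagrange_sectionRep_eq_zero (hL : IsSmoothLagrangian L) (hU : IsOpen U)
    (hσ : IsSmoothSectionOn σ U) (hint : IsIntegralSectionOn h σ U)
    (hp : ∀ x ∈ U, (h (σ x)).IsHorizontalProjector)
    (hs : ∀ x ∈ U, (h (σ x)).SolvesDynamicalEq η L) {x : Fin m → ℝ}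
    (hx : x ∈ sectionDomain σ U e) (α : Fin n) :
    eulerLagrange η L e α x (fun β J =>
      iterPartial J (e.sectionRep (fun y => (σ y).value) β) x) = 0 := by
  have hV := isOpen_sectionDomain (e := e) hU hσ
  have hP : ∀ (I : MultiIdx m r) i,
      ContDiffOn ℝ ∞ (fun z => (mixedRep σ e z).2.2.1 α I i) (sectionDomain σ U e) := by
    intro I i
    have h0 : ContDiff ℝ ∞ fun w : WCoord m n r => w.2.2.1 α I i := by fun_prop
    exact h0.comp_contDiffOn (contDiffOn_mixedRep hσ)
  rw [← sum_iterPartial_momenta_eq_zero hV hP hx]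
  refine Finset.sum_congr rfl fun J _ => ?_
  congr 1
  set G : JetFunction m n := fun x' u' =>
    fderiv ℝ (fun y : JetCoord m n (r + 1) => density η.toFun e.base y.1 * lagrangianRep L e y)
      (x', fun β K => u' β K.1) (jetDu α J) with hGdef
  have hG : IsJetSmooth e.total.target G :=
    ⟨r + 1, fun y => fderiv ℝ (fun y : JetCoord m n (r + 1) =>
        density η.toFun e.base y.1 * lagrangianRep L e y) y (jetDu α J),
      ((contDiffOn_density_mul_lagrangianRep hL).fderiv_of_isOpen
        (isOpen_jetDomain e.total.open_target) (m := ∞) (by simp)).clm_apply contDiffOn_const,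
      fun _ _ _ => rfl⟩
  have hO : ∀ z ∈ sectionDomain σ U e,
      (z, fun β => e.sectionRep (fun y => (σ y).value) β z) ∈ e.total.target := by
    intro z hz
    have h1 := mixedRep_zero_mem_target hz
    rw [mixedRep_fst hσ hz] at h1
    simpa only [mixedRep_zero_eq_sectionRep hz] using h1
  refine (iterTotal_prolongation e.total.open_target hV (contDiffOn_sectionRep hσ) hO hG J.1
    hx).trans (iterPartial_congr hV (fun z hz => ?_) J.1 hx)
  rw [← (integralSection_equations hL hU hσ hint hp hs hz α).2 J]
  simp only [hGdef, mixedRep_eq_iterPartial hL hU hσ hint hp hs _ _ hz]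

end Solution

end SkinnerRusk

theorem mainTheorem1 {m n r : ℕ}
    {M : Type*} [TopologicalSpace M] [ChartedSpace (EuclideanSpace ℝ (Fin m)) M]
    [IsManifold (𝓡 m) ∞ M]
    {E : Type*} [TopologicalSpace E] [ChartedSpace (EuclideanSpace ℝ (Fin (m + n))) E]
    [IsManifold (𝓡 (m + n)) ∞ E]
    (π : E → M) (hπ : Manifold.IsSubmersion (𝓡 (m + n)) (𝓡 m) ∞ π)
    (η : VolumeForm m M)
    (L : Jet m n π (r + 1) → ℝ) (hL : IsSmoothLagrangian L)
    (h : ∀ w : MixedSpace m n π r, TangentEnd w)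
    (hh : IsSolutionAlong η L (finalConstraintSet η L) h)
    (U : Set M) (hU : IsOpen U)
    (σ : M → MixedSpace m n π r) (hσ : IsSmoothSectionOn σ U)
    (hσf : ∀ x ∈ U, σ x ∈ finalConstraintSet η L)
    (hint : IsIntegralSectionOn h σ U) :
    (∀ x ∈ U, ∃ hx : IsLocalSectionAt m n π (fun y => (σ y).value) x,
      (σ x).jet = Jet.mk (r + 1) x (fun y => (σ y).value) hx) ∧
    (∀ e : AdaptedChart m n π, ∀ x ∈ U, (σ x).value ∈ e.total.source → ∀ α : Fin n,
      eulerLagrange η L e α (e.base x) (fun β J =>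
        iterPartial J (e.sectionRep (fun y => (σ y).value) β) (e.base x)) = 0) := by
  have hp : ∀ x ∈ U, (h (σ x)).IsHorizontalProjector := fun x hx => (hh _ (hσf x hx)).1
  have hs : ∀ x ∈ U, (h (σ x)).SolvesDynamicalEq η L := fun x hx => (hh _ (hσf x hx)).2.2
  refine ⟨fun x hx => ?_, fun e x hx hxe α => ?_⟩
  · have hloc := isLocalSectionAt_value hπ hU hσ hx
    exact ⟨hloc, jet_eq_mk_value hL hU hσ hint hp hs hx hloc⟩
  · exact eulerLagrange_sectionRep_eq_zero hL hU hσ hint hp hs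
      (base_mem_sectionDomain hσ hx (MixedSpace.mem_domain_iff.mpr hxe)) α
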